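/- Let $(\mathcal A,\varphi)$ be a noncommutative $*$-probability space: $\mathcal A$ is a unital $*$-algebra over $\mathbb C$ and $\varphi:\mathcal A\to\mathbb C$ is linear with $\varphi(1)=1$ and $\varphi(a^*a)\ge 0$ for all $a\in\mathcal A$. The joint free cumulants $\mathcal R_n:\mathcal A^n\to\mathbb C$, $n\ge 1$, are defined recursively by $$\varphi(a_1\cdots a_n)=\sum_{\chi\in NC(n)}\ \prod_{B\in\chi}\mathcal R_{|B|}(a_i,\ i\in B),\qquad n=1,2,\ldots,$$ where $NC(n)$ is the set of non-crossing partitions of $\{1,\dots,n\}$ and the arguments within a block are in increasing order; $\mathcal R_n(a):=\mathcal R_n(a,\ldots,a)$. Let $\lambda>1$. A self-adjoint $X\in\mathcal A$ is said to have the free Poisson distribution with rate $\lambda$ and jump size $\alpha=1$ if $\varphi(X^r)=\int t^r\,\nu(dt)$ for all $r\ge1$, where $\nu$ has density $$\frac{1}{2\pi x}\sqrt{4\lambda-(x-1-\lambda)^2}\quad\text{on } \big((1-\sqrt\lambda)^2,(1+\sqrt\lambda)^2\big).$$ (a) If $\mathcal A$ is a $C^*$-algebra, $\varphi$ is faithful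 (i.e. $\varphi(a^*a)=0$ implies $a=0$) and $X$ has this distribution, then $X$ is invertible. (b) If $X\in\mathcal A$ has this distribution and is invertible, then for all $m\ge1$ and all integers $i_1,\dots,i_m\ge0$, $$\mathcal R_{i_1+\cdots+i_m+m}\big(X^{-1},\underbrace{X,\ldots,X}_{i_1},X^{-1},\underbrace{X,\ldots,X}_{i_2},\ldots,X^{-1},\underbrace{X,\ldots,X}_{i_m}\big)=\begin{cases}0 & \text{if } i_k>1 \text{ for some } k,\\ (-1)^{i_1+\cdots+i_m}\,\mathcal R_m(X^{-1}) & \text{if } i_k\le 1 \text{ for all } k.\end{cases}$$ -/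

import Mathlib

open MeasureTheory

noncomputable section

namespace FreeProb

section ProbabilitySpace

open scoped ComplexOrder

variable {A : Type*} [Ring A] [StarRing A] [Algebra ℂ A]

/-- `φ` is a state on the unital `*`-algebra `A`, that is, `(A, φ)` is a noncommutative
`*`-probability space: `φ` is linear, `φ 1 = 1`, and `φ (a⋆ a)` is a nonnegative real. -/
structure IsState (φ : A →ₗ[ℂ] ℂ) : Prop where
  map_one : φ 1 = 1
  nonneg : ∀ a : A, 0 ≤ φ (star a * a)

/-- `φ` is faithful: `φ (a⋆ a) = 0` only for `a = 0`. -/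
def IsFaithful (φ : A →ₗ[ℂ] ℂ) : Prop :=
  ∀ a : A, φ (star a * a) = 0 → a = 0

end ProbabilitySpace

/-- The density of the absolutely continuous part of the free Poisson (Marchenko-Pastur) law of
rate `lam` and jump size `α`, carried by the interval `(α (1 - √lam)², α (1 + √lam)²)`. -/
def freePoissonDensity (lam α : ℝ) : ℝ → ℝ :=
  (Set.Ioo (α * (1 - √lam) ^ 2) (α * (1 + √lam) ^ 2)).indicator fun x =>
    1 / (2 * Real.pi * α * x) * √(4 * lam * α ^ 2 - (x - α * (1 + lam)) ^ 2)

/-- The free Poisson (Marchenko-Pastur) law of rate `lam` and jump size `α`. Its absolutely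
continuous part has total mass `min 1 lam`, so the atom at `0` is absent when `1 ≤ lam`. -/
def freePoisson (lam α : ℝ) : Measure ℝ :=
  ENNReal.ofReal (max 0 (1 - lam)) • Measure.dirac 0 +
    (volume : Measure ℝ).withDensity fun x => ENNReal.ofReal (freePoissonDensity lam α x)

/-- `X` is a self-adjoint random variable whose distribution is the free Poisson law of rate `lam`
and jump size `α`: its moments are those of that (compactly supported) law. -/
structure IsFreePoisson {A : Type*} [Ring A] [StarRing A] [Algebra ℂ A]
    (φ : A →ₗ[ℂ] ℂ) (X : A) (lam α : ℝ) : Prop where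
  isSelfAdjoint : IsSelfAdjoint X
  moment : ∀ r : ℕ, 1 ≤ r → φ (X ^ r) = ((∫ t : ℝ, t ^ r ∂(freePoisson lam α) : ℝ) : ℂ)

/-- A partition of `{0, …, n-1}` is non-crossing if there are no two distinct blocks `B`, `C` and
`i₁ < j₁ < i₂ < j₂` with `i₁, i₂ ∈ B` and `j₁, j₂ ∈ C`. -/
def IsNonCrossing {n : ℕ} (π : Finpartition (Finset.univ : Finset (Fin n))) : Prop :=
  ∀ B ∈ π.parts, ∀ C ∈ π.parts, B ≠ C →
    ∀ i₁ ∈ B, ∀ i₂ ∈ B, ∀ j₁ ∈ C, ∀ j₂ ∈ C, ¬ (i₁ < j₁ ∧ j₁ < i₂ ∧ i₂ < j₂)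

open scoped Classical in
/-- The finite set `NC(n)` of non-crossing partitions. -/
def NC (n : ℕ) : Finset (Finpartition (Finset.univ : Finset (Fin n))) :=
  Finset.univ.filter IsNonCrossing

/-- The partition with the single block `{0, …, n-1}` (for `n ≥ 1`). -/
abbrev oneBlock (n : ℕ) : Finpartition (Finset.univ : Finset (Fin n)) := ⊤

/-- Every block of a partition other than the one-block partition is smaller than `n`. -/
theorem card_lt_of_ne_oneBlock {n : ℕ} {π : Finpartition (Finset.univ : Finset (Fin n))}
    (hπ : π ≠ oneBlock n) {B : Finset (Fin n)} (hB : B ∈ π.parts) : B.card < n := by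
  by_contra h
  have hBu : B = Finset.univ := by
    rw [← Finset.card_eq_iff_eq_univ, Fintype.card_fin]
    exact le_antisymm (by simpa using Finset.card_le_univ B) (not_lt.mp h)
  apply hπ
  refine le_antisymm le_top ?_
  intro C hC
  have hne : (Finset.univ : Finset (Fin n)) ≠ ⊥ := hBu ▸ π.ne_bot hB
  exact ⟨B, hB, by rw [hBu]; exact Finset.subset_univ C⟩

/-- The word `X⁻¹, X, …, X, X⁻¹, X, …, X, …, X⁻¹, X, …, X` made of `m` groups, the `k`-th of which
is one `X⁻¹` followed by `i k` copies of `X`. -/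
def word {A : Type*} [Ring A] (X : Aˣ) {m : ℕ} (i : Fin m → ℕ) : List A :=
  (List.ofFn i).flatMap fun k => (↑X⁻¹ : A) :: List.replicate k (X : A)

theorem length_word {A : Type*} [Ring A] (X : Aˣ) {m : ℕ} (i : Fin m → ℕ) :
    (word X i).length = ∑ k, i k + m := by
  simp [word, List.length_flatMap, List.sum_ofFn, List.map_ofFn, Function.comp_def,
    Finset.sum_add_distrib]

variable {A : Type*} [Ring A] [Algebra ℂ A]

open scoped Classical in
/-- The `n`-th joint free cumulant `R_n(x_0, …, x_{n-1})`, defined recursively by solving the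
moment-cumulant formula `φ(x_0 ⋯ x_{n-1}) = ∑_{π ∈ NC(n)} ∏_{B ∈ π} R_{|B|}(x_i, i ∈ B)` for the
term of the one-block partition. Inside a block the arguments are listed in increasing order. -/
def freeCumulant (φ : A →ₗ[ℂ] ℂ) (n : ℕ) (x : Fin n → A) : ℂ :=
  φ (List.ofFn x).prod -
    ∑ π : {π : Finpartition (Finset.univ : Finset (Fin n)) // π ∈ NC n ∧ π ≠ oneBlock n},
      ∏ B : {B : Finset (Fin n) // B ∈ π.1.parts},
        freeCumulant φ B.1.card (fun j => x (B.1.orderEmbOfFin rfl j))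
termination_by n
decreasing_by exact card_lt_of_ne_oneBlock π.2.2 B.2

/-- The joint free cumulant of a list of random variables. -/
def cumulantList (φ : A →ₗ[ℂ] ℂ) (l : List A) : ℂ :=
  freeCumulant φ l.length l.get

theorem oneBlock_parts_subset (n : ℕ) : (oneBlock n).parts ⊆ {Finset.univ} :=
  Finpartition.parts_top_subset _

theorem oneBlock_parts {n : ℕ} (hn : 1 ≤ n) : (oneBlock n).parts = {Finset.univ} := by
  refine (Finset.subset_singleton_iff.mp (oneBlock_parts_subset n)).resolve_left fun h => ?_
  have h0 := (oneBlock n).parts_eq_empty_iff.mp h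
  have : (⟨0, hn⟩ : Fin n) ∈ (Finset.univ : Finset (Fin n)) := Finset.mem_univ _
  rw [h0] at this
  simp at this

theorem oneBlock_mem_NC (n : ℕ) : oneBlock n ∈ NC n := by
  classical
  simp only [NC, Finset.mem_filter, Finset.mem_univ, true_and]
  intro B hB C hC hBC
  have h1 := Finset.mem_singleton.mp (oneBlock_parts_subset n hB)
  have h2 := Finset.mem_singleton.mp (oneBlock_parts_subset n hC)
  exact absurd (h1.trans h2.symm) hBC

theorem freeCumulant_congr (φ : A →ₗ[ℂ] ℂ) {n k : ℕ} (h : k = n) (x : Fin n → A) :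
    freeCumulant φ k (fun j => x (Fin.cast h j)) = freeCumulant φ n x := by
  subst h; rfl

/-- The moment-cumulant formula, which characterizes the free cumulants. -/
theorem moment_eq_sum_freeCumulant (φ : A →ₗ[ℂ] ℂ) {n : ℕ} (hn : 1 ≤ n) (x : Fin n → A) :
    φ (List.ofFn x).prod =
      ∑ π ∈ NC n, ∏ B ∈ π.parts, freeCumulant φ B.card (fun j => x (B.orderEmbOfFin rfl j)) := by
  classical
  rw [← Finset.add_sum_erase _ _ (oneBlock_mem_NC n), oneBlock_parts hn, Finset.prod_singleton]
  have hc : (Finset.univ : Finset (Fin n)).card = n := by simp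
  have h1 : freeCumulant φ (Finset.univ : Finset (Fin n)).card
      (fun j => x ((Finset.univ : Finset (Fin n)).orderEmbOfFin rfl j)) = freeCumulant φ n x := by
    rw [← freeCumulant_congr φ hc x]
    congr 1
    funext j
    congr 1
    have := Finset.orderEmbOfFin_unique' (s := (Finset.univ : Finset (Fin n))) rfl
      (f := (Fin.castOrderIso hc).toOrderEmbedding) (fun _ => Finset.mem_univ _)
    rw [← this]
    rfl
  rw [h1, freeCumulant]
  have h2 : ∑ π ∈ (NC n).erase (oneBlock n), ∏ B ∈ π.parts,
        freeCumulant φ B.card (fun j => x (B.orderEmbOfFin rfl j)) =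
      ∑ π : {π : Finpartition (Finset.univ : Finset (Fin n)) // π ∈ NC n ∧ π ≠ oneBlock n},
        ∏ B : {B : Finset (Fin n) // B ∈ π.1.parts},
          freeCumulant φ B.1.card (fun j => x (B.1.orderEmbOfFin rfl j)) := by
    rw [Finset.sum_subtype (p := fun π => π ∈ NC n ∧ π ≠ oneBlock n) _
      (fun π => by rw [Finset.mem_erase, and_comm])]
    refine Finset.sum_congr rfl fun π _ => ?_
    rw [Finset.prod_subtype (p := fun B => B ∈ π.1.parts) _ (fun B => Iff.rfl)]
  rw [h2]
  ring

end FreeProb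

end

/-!
Both parts rest on the explicit moments of the free Poisson law `ν` of rate `lam > 1`.

For the invertibility, the spectrum of `X` lies in the support of `ν` because the state is faithful:
if `f` is continuous and vanishes on the support, then `φ (f(X)²) = ∫ f² dν = 0` by polynomial
approximation, whence `f(X) = 0`. The support does not contain `0`
(`isUnit_of_isFreePoisson`). This needs that `ν` has mass `1`, as an atom at `0` would not be seen
by the moments of positive order.

For the cumulants, write `Y = X⁻¹` and `c = lam - 1`. The sum over the non-crossing partitions of a
word is decomposed according to the block of the first, or of the last, letter (`moment_cons`,
`moment_concat`). The result is the linear operator `blockSum`, which takes the weights of the block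
of an adjoined letter to the moments. It is injective (`blockSum_injective`), and composing it with
itself amounts to a convolution of the weights (`blockSum_blockSum`). These two facts turn each
identity between moments into one between cumulants:

* commuting variables have cyclically invariant cumulants (`cumulantList_cyclic`);
* from `Y * X = 1`, the contraction rule `R(Y, X, w) = - ∑ R(X, u) R(Y, v)`, summed over the
  factorizations `w = uv` of a nonempty word `w` (`cumulantList_contract`);
* the quadratic recursion for the moments of `X` says that all free cumulants of `X` are `lam`
  (`cumulantList_replicate_of_recursion`);
* the quadratic recursion for the moments of `Y` says that `κ n = R_n(Y)` satisfies
  `c κ n = ∑ κ i κ (n - i)` for `n ≥ 2`, with `c κ 1 = 1` (`cumulantList_replicate_recursion`).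

These properties determine the cumulants of all words in `X` and `Y` by induction on the length: a
word that contains both letters may be rotated until it begins with `Y, X`, and is then given by the
contraction rule (`apply_boolWord`).

The moments of `ν` satisfy a three-term linear recursion by integration by parts, which makes their
generating series a root of a quadratic polynomial (`quadratic_recursion_of_three_term`). The
substitution `t ↦ c² / t` relates the moments of negative order to those of nonnegative order
(`mpMoment_neg`). Finally `φ (Y ^ k) = ∫ t ^ (-k) dν` holds in any `*`-algebra by the Cauchy-Schwarz
inequality for `φ` (`moment_inv_pow`).
-/

namespace FreeProb

/-! ### Sums over the block of an adjoined letter -/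

section BlockSum

variable {α β : Type*}

/-- `blockSum M K F w` is the sum over all sublists `s` of the word `w` of `K s` times the product
of the weights of the gaps that `s` leaves in `w`: the gap before the first letter of `s` has
weight `F`, every later gap has weight `M`. If `s` is empty, then `w` is a single gap of
weight `F`. -/
def blockSum (M : List α → ℂ) : (List α → ℂ) → (List α → ℂ) → List α → ℂ
  | K, F, [] => F [] * K []
  | K, F, x :: w =>
    F [] * blockSum M (fun l => K (x :: l)) M w + blockSum M K (fun l => F (x :: l)) w

/-- The convolution `∑ K₁ u * K₂ v` over all factorizations of a word as `u ++ v`. -/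
def conv : (List α → ℂ) → (List α → ℂ) → List α → ℂ
  | K₁, K₂, [] => K₁ [] * K₂ []
  | K₁, K₂, x :: w => K₁ [] * K₂ (x :: w) + conv (fun l => K₁ (x :: l)) K₂ w

/-- The unit for `conv`: the indicator function of the empty word. -/
def emptyWord (l : List α) : ℂ := if l.isEmpty then 1 else 0

@[simp] theorem emptyWord_nil : emptyWord ([] : List α) = 1 := rfl

@[simp] theorem emptyWord_cons (x : α) (l : List α) : emptyWord (x :: l) = 0 := rfl

theorem blockSum_linear_right (M : List α → ℂ) (K : List α → ℂ) (c : ℂ) (w : List α) :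
    ∀ F G : List α → ℂ, blockSum M K (fun l => c * F l + G l) w =
      c * blockSum M K F w + blockSum M K G w := by
  induction w with
  | nil => intro F G; simp only [blockSum]; ring
  | cons x w ih =>
    intro F G
    simp only [blockSum]
    rw [ih]
    ring

theorem blockSum_linear_left (M : List α → ℂ) (c : ℂ) (w : List α) :
    ∀ K L F : List α → ℂ, blockSum M (fun l => c * K l + L l) F w =
      c * blockSum M K F w + blockSum M L F w := by
  induction w with
  | nil => intro K L F; simp only [blockSum]; ring
  | cons x w ih =>
    intro K L F
    simp only [blockSum]
    rw [ih, ih]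
    ring

/-- Nested blocks: if the first gap is itself weighted by a sum over a block, then the two blocks
may be read as one block whose weight is the convolution of the two weights. -/
theorem blockSum_blockSum (M : List α → ℂ) (w : List α) :
    ∀ K₁ F K : List α → ℂ,
      blockSum M K (blockSum M K₁ F) w = blockSum M (conv K₁ K) F w := by
  induction w with
  | nil => intro K₁ F K; simp only [blockSum, conv]; ring
  | cons x w ih =>
    intro K₁ F K
    simp only [blockSum, conv]
    rw [blockSum_linear_right, blockSum_linear_left, ih, ih]
    ring

theorem blockSum_eq_zero (M : List α → ℂ) (w : List α) :
    ∀ K F : List α → ℂ, (∀ l, l.length ≤ w.length → K l = 0) → blockSum M K F w = 0 := by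
  induction w with
  | nil => intro K F h; simp [blockSum, h]
  | cons x w ih =>
    intro K F h
    simp only [blockSum]
    rw [ih _ _ fun l hl => h _ (by simpa using hl),
      ih _ _ fun l hl => h _ (by simp only [List.length_cons]; omega)]
    ring

/-- The term of the full sublist is the only one that involves `K` at words of full length. -/
theorem blockSum_eq_apply (M : List α → ℂ) (hM : M [] = 1) (w : List α) :
    ∀ K F : List α → ℂ, F [] = 1 → (∀ l, l.length < w.length → K l = 0) →
      blockSum M K F w = K w := by
  induction w with
  | nil => intro K F hF h; simp [blockSum, hF]
  | cons x w ih =>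
    intro K F hF h
    simp only [blockSum]
    rw [ih _ _ hM fun l hl => h _ (by simpa using hl),
      blockSum_eq_zero M w _ _ fun l hl => h _ (by simp only [List.length_cons]; omega), hF]
    ring

theorem blockSum_injective {M K L : List α → ℂ} (hM : M [] = 1)
    (h : ∀ w, blockSum M K M w = blockSum M L M w) : K = L := by
  have h0 : ∀ w, blockSum M (fun l => (-1) * L l + K l) M w = 0 := by
    intro w
    rw [blockSum_linear_left, h w]
    ring
  have h1 : ∀ n : ℕ, ∀ w : List α, w.length = n → (-1) * L w + K w = 0 := by
    intro n
    induction n using Nat.strong_induction_on with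
    | _ n ih =>
      intro w hw
      rw [← h0 w]
      exact (blockSum_eq_apply M hM w (fun l => (-1) * L l + K l) M hM
        fun l hl => ih _ (hw ▸ hl) l rfl).symm
  funext w
  linear_combination h1 _ w rfl

theorem blockSum_emptyWord (M : List α → ℂ) (w : List α) :
    ∀ F : List α → ℂ, blockSum M emptyWord F w = F w := by
  induction w with
  | nil => intro F; simp [blockSum]
  | cons x w ih =>
    intro F
    simp only [blockSum, emptyWord_cons]
    rw [ih, blockSum_eq_zero M w _ _ fun _ _ => rfl]
    ring

theorem blockSum_map (f : β → α) (M : List α → ℂ) (w : List β) :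
    ∀ K F : List α → ℂ, blockSum M K F (w.map f) =
      blockSum (fun l => M (l.map f)) (fun l => K (l.map f)) (fun l => F (l.map f)) w := by
  induction w with
  | nil => intro K F; simp [blockSum]
  | cons x w ih => intro K F; simp only [blockSum, List.map_cons, ih, List.map_nil]

/-- The sum over a block only involves sublists of the given word. -/
theorem blockSum_congr {M N : List α → ℂ} (w : List α) :
    ∀ {K L F G : List α → ℂ}, (∀ l, l.Sublist w → M l = N l) → (∀ l, l.Sublist w → K l = L l) →
      (∀ l, l.Sublist w → F l = G l) → blockSum M K F w = blockSum N L G w := by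
  induction w with
  | nil =>
    intro K L F G _ hK hF
    simp [blockSum, hK [] (List.Sublist.refl _), hF [] (List.Sublist.refl _)]
  | cons x w ih =>
    intro K L F G hM hK hF
    simp only [blockSum]
    rw [hF [] (List.nil_sublist _), ih (fun l hl => hM l (hl.cons x))
      (fun l hl => hK (x :: l) (hl.cons_cons x)) (fun l hl => hM l (hl.cons x)),
      ih (fun l hl => hM l (hl.cons x)) (fun l hl => hK l (hl.cons x))
      (fun l hl => hF (x :: l) (hl.cons_cons x))]

end BlockSum

/-! ### Sums over non-crossing partitions of finite sets of natural numbers -/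

section NonCrossing

/-- `P` is the set of blocks of a non-crossing partition of `T`. -/
structure IsNCPart (T : Finset ℕ) (P : Finset (Finset ℕ)) : Prop where
  nonempty : ∀ B ∈ P, B.Nonempty
  subset : ∀ B ∈ P, B ⊆ T
  cover : ∀ a ∈ T, ∃ B ∈ P, a ∈ B
  eq_of_mem : ∀ B ∈ P, ∀ C ∈ P, ∀ a, a ∈ B → a ∈ C → B = C
  nc : ∀ B ∈ P, ∀ C ∈ P, B ≠ C → ∀ i ∈ B, ∀ k ∈ B, ∀ j ∈ C, ∀ l ∈ C, ¬ (i < j ∧ j < k ∧ k < l)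

/-- No block of `P` has elements on both sides of an element of `S`. -/
def Unseparated (S : Finset ℕ) (P : Finset (Finset ℕ)) : Prop :=
  ∀ B ∈ P, ∀ i ∈ B, ∀ k ∈ B, ∀ s ∈ S, ¬ (i < s ∧ s < k)

open scoped Classical in
/-- The non-crossing partitions of `T`, each given by its set of blocks. -/
noncomputable def ncParts (T : Finset ℕ) : Finset (Finset (Finset ℕ)) :=
  T.powerset.powerset.filter (IsNCPart T)

theorem mem_ncParts {T : Finset ℕ} {P : Finset (Finset ℕ)} : P ∈ ncParts T ↔ IsNCPart T P := by
  classical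
  simp only [ncParts, Finset.mem_filter, Finset.mem_powerset, and_iff_right_iff_imp]
  intro h B hB
  exact Finset.mem_powerset.mpr (h.subset B hB)

/-- The sum over the non-crossing partitions of `T` of the product of the weights of the blocks. -/
noncomputable def ncSum (f : Finset ℕ → ℂ) (T : Finset ℕ) : ℂ :=
  ∑ P ∈ ncParts T, ∏ B ∈ P, f B

open scoped Classical in
/-- The sum over those non-crossing partitions of `U` in which every block lies in one of the gaps
of `S`. -/
noncomputable def gapSum (f : Finset ℕ → ℂ) (U S : Finset ℕ) : ℂ :=
  ∑ P ∈ (ncParts U).filter (Unseparated S), ∏ B ∈ P, f B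

theorem gapSum_empty (f : Finset ℕ → ℂ) (U : Finset ℕ) : gapSum f U ∅ = ncSum f U := by
  classical
  unfold gapSum ncSum
  rw [Finset.filter_true_of_mem]
  intro P _ B _ i _ k _ s hs
  simp at hs

theorem ncSum_empty (f : Finset ℕ → ℂ) : ncSum f ∅ = 1 := by
  have : ncParts ∅ = {∅} := by
    ext P
    rw [mem_ncParts, Finset.mem_singleton]
    constructor
    · intro h
      rw [Finset.eq_empty_iff_forall_notMem]
      intro B hB
      obtain ⟨x, hx⟩ := h.nonempty B hB
      simpa using h.subset B hB hx
    · rintro rfl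
      constructor <;> simp
  rw [ncSum, this]
  simp

/-- The gap before the least element `a` of `insert a S` contributes a factor. -/
theorem gapSum_split (f : Finset ℕ → ℂ) {G U S : Finset ℕ} {a : ℕ} (hG : ∀ g ∈ G, g < a)
    (hU : ∀ u ∈ U, a < u) (hS : ∀ s ∈ S, a < s) :
    gapSum f (G ∪ U) (insert a S) = ncSum f G * gapSum f U S := by
  classical
  have hGU : ∀ x, x ∈ G → x ∈ U → False := fun x h1 h2 =>
    lt_asymm (hG x h1) (hU x h2)
  unfold ncSum gapSum
  rw [Finset.sum_mul_sum, ← Finset.sum_product']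
  symm
  -- every block of a partition on the left lies on one side of `a`
  have key : ∀ P, IsNCPart (G ∪ U) P → Unseparated (insert a S) P →
      ∀ B ∈ P, B ⊆ G ∨ B ⊆ U := by
    intro P hP hs B hB
    by_contra hcon
    push Not at hcon
    obtain ⟨h1, h2⟩ := hcon
    obtain ⟨x, hxB, hx⟩ := Finset.not_subset.mp h1
    obtain ⟨y, hyB, hy⟩ := Finset.not_subset.mp h2
    have hx' := (Finset.mem_union.mp (hP.subset B hB hxB)).resolve_left hx
    have hy' := (Finset.mem_union.mp (hP.subset B hB hyB)).resolve_right hy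
    exact hs B hB y hyB x hxB a (Finset.mem_insert_self _ _) ⟨hG y hy', hU x hx'⟩
  refine Finset.sum_bij' (fun p _ => p.1 ∪ p.2)
    (fun P _ => (P.filter (· ⊆ G), P.filter (· ⊆ U))) ?_ ?_ ?_ ?_ ?_
  · rintro ⟨P, Q⟩ h
    simp only [Finset.mem_product, Finset.mem_filter, mem_ncParts] at h ⊢
    obtain ⟨hP, hQ, hs⟩ := h
    refine ⟨⟨?_, ?_, ?_, ?_, ?_⟩, ?_⟩
    · intro B hB
      rcases Finset.mem_union.mp hB with hB | hB
      exacts [hP.nonempty B hB, hQ.nonempty B hB]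
    · intro B hB
      rcases Finset.mem_union.mp hB with hB | hB
      exacts [(hP.subset B hB).trans Finset.subset_union_left,
        (hQ.subset B hB).trans Finset.subset_union_right]
    · intro x hx
      rcases Finset.mem_union.mp hx with hx | hx
      · obtain ⟨B, hB, hxB⟩ := hP.cover x hx
        exact ⟨B, Finset.mem_union_left _ hB, hxB⟩
      · obtain ⟨B, hB, hxB⟩ := hQ.cover x hx
        exact ⟨B, Finset.mem_union_right _ hB, hxB⟩
    · intro B hB C hC x hxB hxC
      rcases Finset.mem_union.mp hB with hB | hB <;> rcases Finset.mem_union.mp hC with hC | hC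
      · exact hP.eq_of_mem B hB C hC x hxB hxC
      · exact (hGU x (hP.subset B hB hxB) (hQ.subset C hC hxC)).elim
      · exact (hGU x (hP.subset C hC hxC) (hQ.subset B hB hxB)).elim
      · exact hQ.eq_of_mem B hB C hC x hxB hxC
    · intro B hB C hC hne i hi k hk j hj l hl ⟨h1, h2, h3⟩
      rcases Finset.mem_union.mp hB with hB | hB <;> rcases Finset.mem_union.mp hC with hC | hC
      · exact hP.nc B hB C hC hne i hi k hk j hj l hl ⟨h1, h2, h3⟩
      · have := hG k (hP.subset B hB hk)
        have := hU j (hQ.subset C hC hj)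
        omega
      · have := hG j (hP.subset C hC hj)
        have := hU i (hQ.subset B hB hi)
        omega
      · exact hQ.nc B hB C hC hne i hi k hk j hj l hl ⟨h1, h2, h3⟩
    · intro B hB i hi k hk s hsS ⟨h1, h2⟩
      rcases Finset.mem_union.mp hB with hB | hB
      · have := hG k (hP.subset B hB hk)
        rcases Finset.mem_insert.mp hsS with rfl | hsS
        · omega
        · have := hS s hsS
          omega
      · have := hU i (hQ.subset B hB hi)
        rcases Finset.mem_insert.mp hsS with rfl | hsS
        · omega
        · exact hs B hB i hi k hk s hsS ⟨h1, h2⟩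
  · intro P h
    simp only [Finset.mem_product, Finset.mem_filter, mem_ncParts] at h ⊢
    obtain ⟨hP, hs⟩ := h
    have restrict : ∀ V, (∀ x ∈ V, x ∈ G ∪ U) → (∀ B ∈ P, ∀ x ∈ B, x ∈ V → B ⊆ V) →
        IsNCPart V (P.filter (· ⊆ V)) := by
      intro V hV1 hV2
      refine ⟨?_, ?_, ?_, ?_, ?_⟩
      · intro B hB
        exact hP.nonempty B (Finset.mem_filter.mp hB).1
      · intro B hB
        exact (Finset.mem_filter.mp hB).2
      · intro x hx
        obtain ⟨B, hB, hxB⟩ := hP.cover x (hV1 x hx)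
        exact ⟨B, Finset.mem_filter.mpr ⟨hB, hV2 B hB x hxB hx⟩, hxB⟩
      · intro B hB C hC
        exact hP.eq_of_mem B (Finset.mem_filter.mp hB).1 C (Finset.mem_filter.mp hC).1
      · intro B hB C hC
        exact hP.nc B (Finset.mem_filter.mp hB).1 C (Finset.mem_filter.mp hC).1
    refine ⟨restrict G (fun x hx => Finset.mem_union_left _ hx) ?_,
      restrict U (fun x hx => Finset.mem_union_right _ hx) ?_, ?_⟩
    · intro B hB x hxB hx
      refine (key P hP hs B hB).resolve_right fun h => hGU x hx (h hxB)
    · intro B hB x hxB hx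
      refine (key P hP hs B hB).resolve_left fun h => hGU x (h hxB) hx
    · intro B hB i hi k hk s hsS
      exact hs B (Finset.mem_filter.mp hB).1 i hi k hk s (Finset.mem_insert_of_mem hsS)
  · rintro ⟨P, Q⟩ h
    simp only [Finset.mem_product, Finset.mem_filter, mem_ncParts] at h
    obtain ⟨hP, hQ, hs⟩ := h
    refine Prod.ext ?_ ?_
    · ext B
      simp only [Finset.mem_filter, Finset.mem_union]
      constructor
      · rintro ⟨hB | hB, hBG⟩
        · exact hB
        · obtain ⟨x, hx⟩ := hQ.nonempty B hB
          exact (hGU x (hBG hx) (hQ.subset B hB hx)).elim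
      · exact fun hB => ⟨Or.inl hB, hP.subset B hB⟩
    · ext B
      simp only [Finset.mem_filter, Finset.mem_union]
      constructor
      · rintro ⟨hB | hB, hBU⟩
        · obtain ⟨x, hx⟩ := hP.nonempty B hB
          exact (hGU x (hP.subset B hB hx) (hBU hx)).elim
        · exact hB
      · exact fun hB => ⟨Or.inr hB, hQ.subset B hB⟩
  · intro P h
    simp only [Finset.mem_filter, mem_ncParts] at h
    obtain ⟨hP, hs⟩ := h
    ext B
    simp only [Finset.mem_union, Finset.mem_filter]
    constructor
    · rintro (h | h) <;> exact h.1
    · intro hB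
      rcases key P hP hs B hB with h | h
      exacts [Or.inl ⟨hB, h⟩, Or.inr ⟨hB, h⟩]
  · rintro ⟨P, Q⟩ h
    simp only [Finset.mem_product, Finset.mem_filter, mem_ncParts] at h
    obtain ⟨hP, hQ, hs⟩ := h
    refine (Finset.prod_union ?_).symm
    rw [Finset.disjoint_left]
    intro B hB hB'
    obtain ⟨x, hx⟩ := hP.nonempty B hB
    exact hGU x (hP.subset B hB hx) (hQ.subset B hB' hx)

/-- Decomposition of a sum over non-crossing partitions according to the block of an element `t`
that is smaller, or larger, than all the others. -/
theorem ncSum_insert (f : Finset ℕ → ℂ) {W : Finset ℕ} {t : ℕ}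
    (ht : (∀ w ∈ W, t < w) ∨ (∀ w ∈ W, w < t)) :
    ncSum f (insert t W) = ∑ S ∈ W.powerset, f (insert t S) * gapSum f (W \ S) S := by
  classical
  have htW : t ∉ W := by
    rcases ht with h | h <;> exact fun hm => lt_irrefl _ (h t hm)
  unfold ncSum gapSum
  simp only [Finset.mul_sum]
  rw [Finset.sum_sigma']
  symm
  have hSt : ∀ S, S ⊆ W → t ∉ S := fun S hS h => htW (hS h)
  -- the block of `t`
  have hblock : ∀ P, IsNCPart (insert t W) P → ∃ B ∈ P, t ∈ B := fun P hP =>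
    hP.cover t (Finset.mem_insert_self _ _)
  refine Finset.sum_bij (fun p _ => insert (insert t p.1) p.2) ?_ ?_ ?_ ?_
  · rintro ⟨S, P⟩ h
    simp only [Finset.mem_sigma, Finset.mem_powerset, Finset.mem_filter, mem_ncParts] at h ⊢
    obtain ⟨hS, hP, hs⟩ := h
    have hsub : ∀ B ∈ P, ∀ x ∈ B, x ∈ W ∧ x ∉ S ∧ x ≠ t := by
      intro B hB x hx
      have := Finset.mem_sdiff.mp (hP.subset B hB hx)
      exact ⟨this.1, this.2, fun h => htW (h ▸ this.1)⟩
    refine ⟨?_, ?_, ?_, ?_, ?_⟩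
    · intro B hB
      rcases Finset.mem_insert.mp hB with rfl | hB
      exacts [Finset.insert_nonempty _ _, hP.nonempty B hB]
    · intro B hB
      rcases Finset.mem_insert.mp hB with rfl | hB
      · exact Finset.insert_subset_insert _ hS
      · exact fun x hx => Finset.mem_insert_of_mem (hsub B hB x hx).1
    · intro x hx
      by_cases hxS : x ∈ insert t S
      · exact ⟨_, Finset.mem_insert_self _ _, hxS⟩
      · rw [Finset.mem_insert, not_or] at hxS
        obtain ⟨B, hB, hxB⟩ := hP.cover x
          (Finset.mem_sdiff.mpr ⟨(Finset.mem_insert.mp hx).resolve_left hxS.1, hxS.2⟩)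
        exact ⟨B, Finset.mem_insert_of_mem hB, hxB⟩
    · intro B hB C hC x hxB hxC
      rcases Finset.mem_insert.mp hB with rfl | hB <;> rcases Finset.mem_insert.mp hC with rfl | hC
      · rfl
      · have := hsub C hC x hxC
        rcases Finset.mem_insert.mp hxB with h | h
        exacts [(this.2.2 h).elim, (this.2.1 h).elim]
      · have := hsub B hB x hxB
        rcases Finset.mem_insert.mp hxC with h | h
        exacts [(this.2.2 h).elim, (this.2.1 h).elim]
      · exact hP.eq_of_mem B hB C hC x hxB hxC
    · intro B hB C hC hne i hi k hk j hj l hl ⟨h1, h2, h3⟩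
      rcases Finset.mem_insert.mp hB with rfl | hB <;> rcases Finset.mem_insert.mp hC with rfl | hC
      · exact hne rfl
      · have hj' := (hsub C hC j hj).1
        have hl' := (hsub C hC l hl).1
        rcases Finset.mem_insert.mp hk with rfl | hk
        · rcases ht with h | h
          · have := h j hj'; omega
          · have := h l hl'; omega
        · exact hs C hC j hj l hl k hk ⟨h2, h3⟩
      · have hi' := (hsub B hB i hi).1
        have hk' := (hsub B hB k hk).1
        rcases Finset.mem_insert.mp hj with rfl | hj
        · rcases ht with h | h
          · have := h i hi'; omega
          · have := h k hk'; omega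
        · exact hs B hB i hi k hk j hj ⟨h1, h2⟩
      · exact hP.nc B hB C hC hne i hi k hk j hj l hl ⟨h1, h2, h3⟩
  · rintro ⟨S, P⟩ h ⟨S', P'⟩ h' heq
    simp only [Finset.mem_sigma, Finset.mem_powerset, Finset.mem_filter, mem_ncParts] at h h' heq
    have hnot : ∀ S S' : Finset ℕ, ∀ P, IsNCPart (W \ S) P → insert t S' ∉ P := by
      intro S S' P hP hm
      exact htW (Finset.mem_sdiff.mp (hP.subset _ hm (Finset.mem_insert_self _ _))).1
    have hSS : S = S' := by
      have : insert t S ∈ insert (insert t S') P' := heq ▸ Finset.mem_insert_self _ _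
      have := (Finset.mem_insert.mp this).resolve_right (hnot _ _ _ h'.2.1)
      rw [← Finset.erase_insert (hSt S h.1), this, Finset.erase_insert (hSt S' h'.1)]
    subst hSS
    have hPP : P = P' := by
      rw [← Finset.erase_insert (hnot S S P h.2.1), heq,
        Finset.erase_insert (hnot S S P' h'.2.1)]
    rw [hPP]
  · intro P hP
    rw [mem_ncParts] at hP
    obtain ⟨B, hB, htB⟩ := hblock P hP
    have hins : insert t (B.erase t) = B := Finset.insert_erase htB
    have hW : ∀ C ∈ P, C ≠ B → ∀ x ∈ C, x ∈ W ∧ x ∉ B := by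
      intro C hC hne x hx
      have hxB : x ∉ B := fun h => hne (hP.eq_of_mem C hC B hB x hx h)
      exact ⟨(Finset.mem_insert.mp (hP.subset C hC hx)).resolve_left
        fun h => hxB (h ▸ htB), hxB⟩
    refine ⟨⟨B.erase t, P.erase B⟩, ?_, ?_⟩
    · simp only [Finset.mem_sigma, Finset.mem_powerset, Finset.mem_filter, mem_ncParts]
      refine ⟨?_, ⟨?_, ?_, ?_, ?_, ?_⟩, ?_⟩
      · intro x hx
        rw [Finset.mem_erase] at hx
        exact (Finset.mem_insert.mp (hP.subset B hB hx.2)).resolve_left hx.1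
      · exact fun C hC => hP.nonempty C (Finset.mem_erase.mp hC).2
      · intro C hC x hx
        rw [Finset.mem_erase] at hC
        have := hW C hC.2 hC.1 x hx
        exact Finset.mem_sdiff.mpr ⟨this.1, fun h => this.2 (Finset.mem_erase.mp h).2⟩
      · intro x hx
        rw [Finset.mem_sdiff, Finset.mem_erase] at hx
        obtain ⟨C, hC, hxC⟩ := hP.cover x (Finset.mem_insert_of_mem hx.1)
        refine ⟨C, Finset.mem_erase.mpr ⟨?_, hC⟩, hxC⟩
        rintro rfl
        exact hx.2 ⟨fun h => htW (h ▸ hx.1), hxC⟩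
      · exact fun C hC D hD =>
          hP.eq_of_mem C (Finset.mem_erase.mp hC).2 D (Finset.mem_erase.mp hD).2
      · exact fun C hC D hD => hP.nc C (Finset.mem_erase.mp hC).2 D (Finset.mem_erase.mp hD).2
      · intro C hC i hi k hk s hs ⟨h1, h2⟩
        rw [Finset.mem_erase] at hC hs
        have hi' := (hW C hC.2 hC.1 i hi).1
        have hk' := (hW C hC.2 hC.1 k hk).1
        -- `t` lies outside `C`, so that `t`, `s` and `i`, `k` would cross
        rcases ht with h | h
        · exact hP.nc B hB C hC.2 (Ne.symm hC.1) t htB s hs.2 i hi k hk ⟨h i hi', h1, h2⟩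
        · exact hP.nc C hC.2 B hB hC.1 i hi k hk s hs.2 t htB ⟨h1, h2, h k hk'⟩
    · simp only
      rw [hins, Finset.insert_erase hB]
  · rintro ⟨S, P⟩ h
    simp only [Finset.mem_sigma, Finset.mem_powerset, Finset.mem_filter, mem_ncParts] at h
    rw [Finset.prod_insert]
    intro hm
    exact htW (Finset.mem_sdiff.mp (h.2.1.subset _ hm (Finset.mem_insert_self _ _))).1

/-- Sum over all `S ⊆ W` as in the decomposition by the block of an extreme element, where `G` is
adjoined to the first gap. -/
noncomputable def outerSum (f k : Finset ℕ → ℂ) (G W : Finset ℕ) : ℂ :=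
  ∑ S ∈ W.powerset, k S * gapSum f (G ∪ W \ S) S

theorem outerSum_insert (f k : Finset ℕ → ℂ) {G W : Finset ℕ} {a : ℕ} (hG : ∀ g ∈ G, g < a)
    (hW : ∀ w ∈ W, a < w) :
    outerSum f k G (insert a W) =
      ncSum f G * outerSum f (fun S => k (insert a S)) ∅ W + outerSum f k (insert a G) W := by
  have haW : a ∉ W := fun h => lt_irrefl _ (hW a h)
  unfold outerSum
  rw [Finset.sum_powerset_insert haW, add_comm, Finset.mul_sum]
  congr 1
  · refine Finset.sum_congr rfl fun S hS => ?_
    rw [Finset.mem_powerset] at hS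
    have : insert a W \ insert a S = W \ S := by
      ext x
      simp only [Finset.mem_sdiff, Finset.mem_insert, not_or]
      constructor
      · rintro ⟨h1 | h1, h2, h3⟩
        exacts [(h2 h1).elim, ⟨h1, h3⟩]
      · rintro ⟨h1, h2⟩
        exact ⟨Or.inr h1, fun h => haW (h ▸ h1), h2⟩
    rw [this, gapSum_split f hG (fun u hu => hW u (Finset.mem_sdiff.mp hu).1)
      (fun s hs => hW s (hS hs)), Finset.empty_union]
    ring
  · refine Finset.sum_congr rfl fun S hS => ?_
    rw [Finset.mem_powerset] at hS
    have : G ∪ insert a W \ S = insert a G ∪ W \ S := by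
      rw [Finset.insert_sdiff_of_notMem _ fun h => haW (hS h), Finset.union_insert,
        Finset.insert_union]
    rw [this]

theorem outerSum_eq_blockSum (f : Finset ℕ → ℂ) (w : List ℕ) (hw : w.Pairwise (· < ·)) :
    ∀ (k : Finset ℕ → ℂ) (g : List ℕ), (∀ i ∈ g, ∀ j ∈ w, i < j) →
      outerSum f k g.toFinset w.toFinset =
        blockSum (fun l => ncSum f l.toFinset) (fun l => k l.toFinset)
          (fun l => ncSum f (g ++ l).toFinset) w := by
  induction w with
  | nil =>
    intro k g _
    simp [outerSum, blockSum, gapSum_empty, mul_comm]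
  | cons a w ih =>
    intro k g hg
    rw [List.pairwise_cons] at hw
    rw [List.toFinset_cons, outerSum_insert f k (a := a)
      (fun x hx => hg x (List.mem_toFinset.mp hx) a List.mem_cons_self)
      (fun x hx => hw.1 x (List.mem_toFinset.mp hx))]
    have h1 := ih hw.2 (fun S => k (insert a S)) [] (by simp)
    have h2 := ih hw.2 k (g ++ [a]) (by
      intro i hi j hj
      rcases List.mem_append.mp hi with h | h
      · exact hg i h j (List.mem_cons_of_mem _ hj)
      · rw [List.mem_singleton] at h
        exact h ▸ hw.1 j hj)
    have h3 : (g ++ [a]).toFinset = insert a g.toFinset := by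
      ext x; simp
    rw [h3] at h2
    simp only [List.toFinset_nil] at h1
    rw [h1, h2]
    simp only [blockSum, List.append_nil, List.nil_append, List.toFinset_cons, List.append_assoc,
      List.cons_append]

end NonCrossing

/-! ### The block of the first and of the last factor of a moment -/

section Moments

variable {A : Type*} [Ring A] [Algebra ℂ A]

theorem freeCumulant_eq_cumulantList (φ : A →ₗ[ℂ] ℂ) {n : ℕ} (x : Fin n → A) :
    freeCumulant φ n x = cumulantList φ (List.ofFn x) := by
  unfold cumulantList
  rw [← freeCumulant_congr φ (List.length_ofFn (f := x)) x]
  congr 1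
  funext j
  rw [List.get_eq_getElem, List.getElem_ofFn]
  rfl

theorem sort_map_orderEmbedding {n : ℕ} (e : Fin n ↪o ℕ) (B : Finset (Fin n)) :
    (B.map e.toEmbedding).sort = List.ofFn fun j => e (B.orderEmbOfFin rfl j) := by
  rw [List.ofFn_eq_map]
  change _ = (List.finRange B.card).map (e ∘ B.orderEmbOfFin rfl)
  rw [← List.map_map, Finset.listMap_orderEmbOfFin_finRange]
  exact (Finset.map_sort e.toEmbedding B _ _ fun a _ b _ => e.le_iff_le.symm).symm

/-- The moment-cumulant formula with the factors indexed by an arbitrary finite set of natural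
numbers, the empty set included. -/
theorem ncSum_cumulantList (φ : A →ₗ[ℂ] ℂ) (h1 : φ 1 = 1) (x : ℕ → A) (T : Finset ℕ) :
    ncSum (fun B => cumulantList φ (B.sort.map x)) T = φ ((T.sort.map x).prod) := by
  classical
  rcases T.eq_empty_or_nonempty with rfl | hT
  · simp [ncSum_empty, h1]
  set e : Fin T.card ↪o ℕ := T.orderEmbOfFin rfl with he
  have hTe : (Finset.univ : Finset (Fin T.card)).map e.toEmbedding = T := by
    rw [he]; exact Finset.map_orderEmbOfFin_univ T rfl
  have hmem : ∀ a, a ∈ T ↔ ∃ j, e j = a := by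
    intro a
    conv_lhs => rw [← hTe]
    simp
  have hTs : T.sort.map x = List.ofFn fun j => x (e j) := by
    rw [List.ofFn_eq_map, ← Finset.listMap_orderEmbOfFin_finRange T rfl, List.map_map]
    rfl
  rw [hTs, moment_eq_sum_freeCumulant φ (Finset.card_pos.mpr hT), ncSum]
  symm
  have hinj : Function.Injective (Finset.map e.toEmbedding) := Finset.map_injective _
  refine Finset.sum_bij (fun π _ => π.parts.map ⟨Finset.map e.toEmbedding, hinj⟩) ?_ ?_ ?_ ?_
  · intro π hπ
    have hπ' : IsNonCrossing π := (Finset.mem_filter.mp hπ).2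
    rw [mem_ncParts]
    refine ⟨?_, ?_, ?_, ?_, ?_⟩
    · simp only [Finset.mem_map, Function.Embedding.coeFn_mk]
      rintro _ ⟨B, hB, rfl⟩
      exact (π.nonempty_of_mem_parts hB).map
    · simp only [Finset.mem_map, Function.Embedding.coeFn_mk]
      rintro _ ⟨B, hB, rfl⟩
      conv_rhs => rw [← hTe]
      exact Finset.map_subset_map.mpr (Finset.subset_univ _)
    · intro a ha
      obtain ⟨j, rfl⟩ := (hmem a).mp ha
      obtain ⟨B, hB, hj⟩ := π.exists_mem (Finset.mem_univ j)
      exact ⟨B.map e.toEmbedding, Finset.mem_map.mpr ⟨B, hB, rfl⟩,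
        Finset.mem_map_of_mem _ hj⟩
    · simp only [Finset.mem_map, Function.Embedding.coeFn_mk]
      rintro _ ⟨B, hB, rfl⟩ _ ⟨C, hC, rfl⟩ a haB haC
      obtain ⟨j, hj, rfl⟩ := Finset.mem_map.mp haB
      rw [π.eq_of_mem_parts hB hC hj ((Finset.mem_map' _).mp haC)]
    · simp only [Finset.mem_map, Function.Embedding.coeFn_mk]
      rintro _ ⟨B, hB, rfl⟩ _ ⟨C, hC, rfl⟩ hne i hi k hk j hj l hl
      obtain ⟨i, hi', rfl⟩ := Finset.mem_map.mp hi
      obtain ⟨j, hj', rfl⟩ := Finset.mem_map.mp hj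
      obtain ⟨k, hk', rfl⟩ := Finset.mem_map.mp hk
      obtain ⟨l, hl', rfl⟩ := Finset.mem_map.mp hl
      have := hπ' B hB C hC (fun h => hne (by rw [h])) i hi' k hk' j hj' l hl'
      simpa using this
  · intro π _ π' _ h
    exact Finpartition.ext (Finset.map_injective _ h)
  · intro P hP
    rw [mem_ncParts] at hP
    -- pull the blocks back along `e`
    let g : Finset ℕ → Finset (Fin T.card) := fun B => Finset.univ.filter fun j => e j ∈ B
    have hg : ∀ B ∈ P, (g B).map e.toEmbedding = B := by
      intro B hB
      ext a
      simp only [g, Finset.mem_map, Finset.mem_filter, Finset.mem_univ, true_and]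
      constructor
      · rintro ⟨j, hj, rfl⟩
        exact hj
      · intro ha
        obtain ⟨j, rfl⟩ := (hmem a).mp (hP.subset B hB ha)
        exact ⟨j, ha, rfl⟩
    have hmg : ∀ B j, j ∈ g B ↔ e j ∈ B := by simp [g]
    refine ⟨Finpartition.ofExistsUnique (P.image g) (fun _ _ => Finset.subset_univ _) ?_ ?_,
      ?_, ?_⟩
    · intro j _
      obtain ⟨B, hB, hj⟩ := hP.cover (e j) ((hmem _).mpr ⟨j, rfl⟩)
      refine ⟨g B, ⟨Finset.mem_image_of_mem _ hB, (hmg _ _).mpr hj⟩, ?_⟩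
      rintro D ⟨hD, hjC⟩
      obtain ⟨C, hC, rfl⟩ := Finset.mem_image.mp hD
      rw [hP.eq_of_mem C hC B hB (e j) ((hmg _ _).mp hjC) hj]
    · intro hemp
      obtain ⟨B, hB, hgB⟩ := Finset.mem_image.mp hemp
      have := hg B hB
      rw [hgB, Finset.map_empty] at this
      exact Finset.not_nonempty_empty (this ▸ hP.nonempty B hB)
    · refine Finset.mem_filter.mpr ⟨Finset.mem_univ _, ?_⟩
      intro B hB C hC hne i hi k hk j hj l hl hcr
      obtain ⟨B, hB', rfl⟩ := Finset.mem_image.mp hB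
      obtain ⟨C, hC', rfl⟩ := Finset.mem_image.mp hC
      refine hP.nc B hB' C hC' (fun h => hne (by rw [h])) (e i) ((hmg _ _).mp hi) (e k)
        ((hmg _ _).mp hk) (e j) ((hmg _ _).mp hj) (e l) ((hmg _ _).mp hl) ?_
      simpa using hcr
    · ext B
      simp only [Finpartition.ofExistsUnique, Finset.mem_map, Finset.mem_image,
        Function.Embedding.coeFn_mk]
      constructor
      · rintro ⟨_, ⟨C, hC, rfl⟩, rfl⟩
        rwa [hg C hC]
      · intro hB
        exact ⟨g B, ⟨B, hB, rfl⟩, hg B hB⟩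
  · intro π _
    rw [Finset.prod_map]
    refine Finset.prod_congr rfl fun B _ => ?_
    rw [Function.Embedding.coeFn_mk, sort_map_orderEmbedding, List.map_ofFn,
      freeCumulant_eq_cumulantList]
    rfl

theorem sort_toFinset_of_pairwise {l : List ℕ} (hl : l.Pairwise (· < ·)) : l.toFinset.sort = l :=
  (List.toFinset_sort (r := (· ≤ ·)) (hl.imp fun h => h.ne)).mpr (hl.imp fun h => h.le)

/-- Summation over the block of an extreme index `t`; `ins` inserts `t` at that end of a list. -/
theorem moment_eq_blockSum_of_extreme (φ : A →ₗ[ℂ] ℂ) (h1 : φ 1 = 1) (x : ℕ → A) {t : ℕ}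
    {w : List ℕ} (hw : w.Pairwise (· < ·)) (ht : (∀ i ∈ w, t < i) ∨ ∀ i ∈ w, i < t)
    (ins : List ℕ → List ℕ) (hins : ∀ l, l.Sublist w → (ins l).Pairwise (· < ·))
    (hins' : ∀ l, (ins l).toFinset = insert t l.toFinset)
    (K : List A → ℂ) (hK : ∀ l, K (l.map x) = cumulantList φ ((ins l).map x)) :
    φ (((ins w).map x).prod) =
      blockSum (fun l => φ l.prod) K (fun l => φ l.prod) (w.map x) := by
  set f : Finset ℕ → ℂ := fun B => cumulantList φ (B.sort.map x) with hf
  have hN : ∀ l : List ℕ, l.Pairwise (· < ·) → ncSum f l.toFinset = φ ((l.map x).prod) := by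
    intro l hl
    rw [hf, ncSum_cumulantList φ h1, sort_toFinset_of_pairwise hl]
  rw [← hN _ (hins w (List.Sublist.refl w)), hins', ncSum_insert f (by simpa using ht),
    blockSum_map]
  have h2 := outerSum_eq_blockSum f w hw (fun S => f (insert t S)) [] (by simp)
  simp only [outerSum, List.toFinset_nil, Finset.empty_union, List.nil_append] at h2
  rw [h2]
  refine blockSum_congr w (fun l hl => hN l (hw.sublist hl)) (fun l hl => ?_)
    (fun l hl => hN l (hw.sublist hl))
  rw [hK, ← hins', hf]
  simp only
  rw [sort_toFinset_of_pairwise (hins l hl)]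

/-- A moment as the sum over the block that contains the first factor. -/
theorem moment_cons (φ : A →ₗ[ℂ] ℂ) (h1 : φ 1 = 1) (a : A) (w : List A) :
    φ (a :: w).prod = blockSum (fun l => φ l.prod) (fun l => cumulantList φ (a :: l))
      (fun l => φ l.prod) w := by
  have h := moment_eq_blockSum_of_extreme φ h1 (fun i => (a :: w).getD i 0) (t := 0)
    (w := (List.range' 1 w.length)) List.pairwise_lt_range'
    (Or.inl fun i hi => by rw [List.mem_range'_1] at hi; omega) (fun l => 0 :: l)
    (fun l hl => List.pairwise_cons.mpr ⟨fun i hi => by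
      have := hl.subset hi
      rw [List.mem_range'_1] at this; omega, List.Pairwise.sublist hl List.pairwise_lt_range'⟩)
    (fun l => by simp) (fun l => cumulantList φ (a :: l)) (fun l => rfl)
  have hw : (List.range' 1 w.length).map (fun i => (a :: w).getD i 0) = w := by
    refine List.ext_getElem (by simp) fun i h2 h3 => ?_
    simp [Nat.add_comm 1 i, List.getElem?_eq_getElem h3]
  rw [List.map_cons, hw] at h
  exact h

/-- A moment as the sum over the block that contains the last factor. -/
theorem moment_concat (φ : A →ₗ[ℂ] ℂ) (h1 : φ 1 = 1) (a : A) (w : List A) :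
    φ (w ++ [a]).prod = blockSum (fun l => φ l.prod) (fun l => cumulantList φ (l ++ [a]))
      (fun l => φ l.prod) w := by
  have hx : (w ++ [a]).getD w.length 0 = a := by simp
  have h := moment_eq_blockSum_of_extreme φ h1 (fun i => (w ++ [a]).getD i 0) (t := w.length)
    (w := (List.range' 0 w.length)) List.pairwise_lt_range'
    (Or.inr fun i hi => by rw [List.mem_range'_1] at hi; omega) (fun l => l ++ [w.length])
    (fun l hl => List.pairwise_append.mpr ⟨List.Pairwise.sublist hl List.pairwise_lt_range',
      List.pairwise_singleton _ _, fun i hi j hj => by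
      have := hl.subset hi
      rw [List.mem_range'_1] at this
      rw [List.mem_singleton] at hj
      omega⟩)
    (fun l => by ext; simp) (fun l => cumulantList φ (l ++ [a]))
    (fun l => by rw [List.map_append, List.map_singleton, hx])
  have hw : (List.range' 0 w.length).map (fun i => (w ++ [a]).getD i 0) = w := by
    refine List.ext_getElem (by simp) fun i h2 h3 => ?_
    simp [List.getElem?_append_left h3, List.getElem?_eq_getElem h3]
  rw [List.map_append, List.map_singleton, hx, hw] at h
  exact h

end Moments

/-! ### Consequences for the cumulants: cyclicity, contraction, one variable -/

section Cumulants

variable {A : Type*} [Ring A] [Algebra ℂ A]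

/-- If `Y * X = 1`, then in a joint cumulant the neighbours `Y, X` may be removed at the cost of
cumulants of two nested blocks. -/
theorem cumulantList_contract (φ : A →ₗ[ℂ] ℂ) (h1 : φ 1 = 1) {X Y : A} (hYX : Y * X = 1)
    (w : List A) :
    cumulantList φ (Y :: X :: w) +
      conv (fun l => cumulantList φ (X :: l)) (fun l => cumulantList φ (Y :: l)) w =
      emptyWord w := by
  set M : List A → ℂ := fun l => φ l.prod with hM
  have hMnil : M [] = 1 := by simp [hM, h1]
  have hcons : ∀ a : A, (fun l => M (a :: l)) =
      blockSum M (fun l => cumulantList φ (a :: l)) M := fun a => funext fun l =>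
    moment_cons φ h1 a l
  have key : (fun l => 1 * cumulantList φ (Y :: X :: l) +
      conv (fun l => cumulantList φ (X :: l)) (fun l => cumulantList φ (Y :: l)) l) =
      emptyWord := by
    refine blockSum_injective hMnil fun w => ?_
    have h2 : M (Y :: X :: w) = M w := by simp [hM, ← mul_assoc, hYX]
    have h3 : M (Y :: X :: w) = blockSum M (fun l => cumulantList φ (Y :: l)) M (X :: w) :=
      moment_cons φ h1 Y (X :: w)
    rw [blockSum, hcons X, blockSum_blockSum, hMnil] at h3
    rw [blockSum_linear_left, blockSum_emptyWord, ← h2, h3]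
  have := congrFun key w
  simpa using this

/-- For commuting variables the joint cumulants are invariant under cyclic permutations. -/
theorem cumulantList_cyclic (φ : A →ₗ[ℂ] ℂ) (h1 : φ 1 = 1) {ι : Type*} (ev : ι → A)
    (hev : ∀ i j, Commute (ev i) (ev j)) (x : ι) (w : List ι) :
    cumulantList φ ((x :: w).map ev) = cumulantList φ ((w ++ [x]).map ev) := by
  have key : (fun w : List ι => cumulantList φ (ev x :: w.map ev)) =
      fun w => cumulantList φ (w.map ev ++ [ev x]) := by
    refine blockSum_injective (M := fun l => φ (l.map ev).prod) (by simp [h1]) fun w => ?_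
    have hc : (ev x :: w.map ev).prod = (w.map ev ++ [ev x]).prod := by
      rw [List.prod_cons, List.prod_append, List.prod_singleton]
      refine Commute.list_prod_right _ _ fun y hy => ?_
      obtain ⟨i, _, rfl⟩ := List.mem_map.mp hy
      exact hev x i
    have h2 := moment_cons φ h1 (ev x) (w.map ev)
    have h3 := moment_concat φ h1 (ev x) (w.map ev)
    rw [blockSum_map] at h2 h3
    rw [← h2, ← h3, hc]
  simpa using congrFun key w

/-- The decomposition by the first factor for a single variable, whose words are
lists over `Unit`. -/
theorem moment_unit (φ : A →ₗ[ℂ] ℂ) (h1 : φ 1 = 1) (a : A) (w : List Unit) :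
    φ (a ^ (w.length + 1)) =
      blockSum (fun l : List Unit => φ (a ^ l.length))
        (fun l => cumulantList φ (List.replicate (l.length + 1) a))
        (fun l => φ (a ^ l.length)) w := by
  have h := moment_cons φ h1 a (w.map fun _ => a)
  rw [blockSum_map] at h
  simpa [List.map_const', List.prod_replicate, pow_succ', List.replicate_succ] using h

/-- The quadratic recursion for the moments says that all free cumulants are equal to `c + 1`. -/
theorem cumulantList_replicate_of_recursion (φ : A →ₗ[ℂ] ℂ) (h1 : φ 1 = 1) (X : A) (c : ℂ)
    (hrec : ∀ n : ℕ, φ (X ^ (n + 1)) =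
      ∑ i ∈ Finset.range (n + 1), φ (X ^ i) * φ (X ^ (n - i)) + c * φ (X ^ n)) (n : ℕ) :
    cumulantList φ (List.replicate (n + 1) X) = c + 1 := by
  set M : List Unit → ℂ := fun l => φ (X ^ l.length) with hM
  have hb : ∀ w : List Unit, ∀ j : ℕ,
      blockSum M (fun _ => c + 1) (fun l => φ (X ^ (j + l.length))) w =
        (c + 1) * φ (X ^ (j + w.length)) +
          ∑ i ∈ Finset.range w.length, φ (X ^ (j + i)) * φ (X ^ (w.length - i)) := by
    intro w
    induction w with
    | nil => intro j; simp [blockSum, mul_comm]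
    | cons x w ih =>
      intro j
      have h0 := ih 0
      have h2 := hrec w.length
      have h3 := ih (j + 1)
      simp only [zero_add] at h0
      rw [Finset.sum_range_succ, Nat.sub_self, pow_zero, h1] at h2
      have h4 : ∀ l : ℕ, j + 1 + l = j + (l + 1) := fun l => by omega
      simp only [blockSum, List.length_nil, add_zero, List.length_cons]
      rw [Finset.sum_range_succ']
      simp only [h4] at h3
      simp only [Nat.add_sub_add_right, add_zero, Nat.sub_zero]
      rw [h3]
      have h5 : blockSum M (fun _ => c + 1) M w = φ (X ^ (w.length + 1)) := by
        rw [hM, h0, h2]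
        ring
      rw [h5]
      ring
  have key : (fun l : List Unit => cumulantList φ (List.replicate (l.length + 1) X)) =
      fun _ => c + 1 := by
    refine blockSum_injective (M := M) (by simp [hM, h1]) fun w => ?_
    have h0 := hb w 0
    have h2 := hrec w.length
    rw [Finset.sum_range_succ, Nat.sub_self, pow_zero, h1] at h2
    simp only [zero_add] at h0
    rw [← moment_unit φ h1 X w, h2, hM, h0]
    ring
  simpa using congrFun key (List.replicate n ())

/-- The quadratic recursion for the moments of the inverse turns into the Catalan recursion for
its free cumulants. -/
theorem cumulantList_replicate_recursion (φ : A →ₗ[ℂ] ℂ) (h1 : φ 1 = 1) (Y : A) (c : ℂ)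
    (hrec : ∀ n : ℕ, c * φ (Y ^ (n + 1)) =
      ∑ i ∈ Finset.range n, φ (Y ^ (i + 1)) * φ (Y ^ (n - i)) + φ (Y ^ n)) (n : ℕ) :
    c * cumulantList φ (List.replicate (n + 1) Y) =
      ∑ i ∈ Finset.range n, cumulantList φ (List.replicate (i + 1) Y) *
        cumulantList φ (List.replicate (n - i) Y) + if n = 0 then 1 else 0 := by
  set M : List Unit → ℂ := fun l => φ (Y ^ l.length) with hM
  set κ : ℕ → ℂ := fun n => cumulantList φ (List.replicate n Y) with hκ
  -- the cumulants, with the value at the empty word replaced by `0`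
  let R : List Unit → ℂ := fun l => if l.length = 0 then 0 else κ l.length
  have hR : ∀ x l, R (x :: l) = κ (l.length + 1) := fun x l => by simp [R]
  have hmom : blockSum M (fun l => κ (l.length + 1)) M = fun l => φ (Y ^ (1 + l.length)) := by
    funext w
    rw [add_comm]
    exact (moment_unit φ h1 Y w).symm
  have hconv : ∀ w : List Unit, ∀ j : ℕ, conv (fun l => κ (j + l.length)) R w =
      ∑ i ∈ Finset.range w.length, κ (j + i) * κ (w.length - i) := by
    intro w
    induction w with
    | nil => intro j; simp [conv, R]
    | cons x w ih =>
      intro j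
      have h3 := ih (j + 1)
      have h4 : ∀ l : ℕ, j + 1 + l = j + (l + 1) := fun l => by omega
      simp only [h4] at h3
      simp only [conv, hR, List.length_cons, List.length_nil]
      rw [Finset.sum_range_succ']
      simp only [h3, Nat.add_sub_add_right, add_zero, Nat.sub_zero]
      ring
  have hblock : ∀ w : List Unit, ∀ j : ℕ, blockSum M R (fun l => φ (Y ^ (j + l.length))) w =
      ∑ i ∈ Finset.range w.length, φ (Y ^ (j + i)) * φ (Y ^ (w.length - i)) := by
    intro w
    induction w with
    | nil => intro j; simp [blockSum, R]
    | cons x w ih =>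
      intro j
      have h3 := ih (j + 1)
      have h4 : ∀ l : ℕ, j + 1 + l = j + (l + 1) := fun l => by omega
      simp only [h4] at h3
      simp only [blockSum, hR, List.length_cons, List.length_nil, hmom]
      rw [Finset.sum_range_succ']
      simp only [h3, Nat.add_sub_add_right, add_zero, Nat.sub_zero]
      rw [add_comm 1 w.length]
      ring
  have key : (fun l : List Unit => c * κ (l.length + 1) +
      ((-1) * conv (fun l => κ (l.length + 1)) R l + 0)) = emptyWord := by
    refine blockSum_injective (M := M) (by simp [hM, h1]) fun w => ?_
    rw [blockSum_linear_left, blockSum_linear_left, blockSum_emptyWord, ← blockSum_blockSum, hmom,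
      hblock, blockSum_eq_zero M w (fun _ => 0) M fun _ _ => rfl]
    have h2 := hrec w.length
    simp only [add_comm 1]
    linear_combination h2
  have h := congrFun key (List.replicate n ())
  have h2 := hconv (List.replicate n ()) 1
  simp only [List.length_replicate, add_comm 1] at h h2
  rw [h2] at h
  have h3 : emptyWord (List.replicate n ()) = if n = 0 then (1 : ℂ) else 0 := by
    cases n <;> simp [List.replicate_succ]
  rw [h3] at h
  linear_combination h

end Cumulants

/-! ### Solving the recursion for the words in two letters -/

section Words

theorem conv_map {α β : Type*} (f : β → α) (w : List β) : ∀ K₁ K₂ : List α → ℂ,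
    conv K₁ K₂ (w.map f) = conv (fun l => K₁ (l.map f)) (fun l => K₂ (l.map f)) w := by
  induction w with
  | nil => intro K₁ K₂; simp [conv]
  | cons x w ih => intro K₁ K₂; simp only [conv, List.map_cons, ih, List.map_nil]

/-- The word in the letters `true` (for `X`) and `false` (for `X⁻¹`) with the given numbers of
letters `true` after each letter `false`. -/
def boolWord (l : List ℕ) : List Bool := l.flatMap fun k => false :: List.replicate k true

/-- The contribution of a run of `k` letters `X` to the joint cumulant. -/
def runSign : ℕ → ℂ
  | 0 => 1
  | 1 => -1
  | _ => 0

@[simp] theorem boolWord_nil : boolWord [] = [] := rfl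

theorem boolWord_cons (k : ℕ) (l : List ℕ) :
    boolWord (k :: l) = false :: (List.replicate k true ++ boolWord l) := by
  simp [boolWord]

theorem boolWord_append (l l' : List ℕ) : boolWord (l ++ l') = boolWord l ++ boolWord l' := by
  simp [boolWord]

theorem boolWord_concat_append (l : List ℕ) (e k : ℕ) :
    boolWord (l ++ [e]) ++ List.replicate k true = boolWord (l ++ [e + k]) := by
  simp [boolWord, List.replicate_append_replicate]

theorem exists_boolWord (u : List Bool) : ∃ l e, false :: u = boolWord (l ++ [e]) := by
  induction u using List.reverseRecOn with
  | nil => exact ⟨[], 0, rfl⟩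
  | append_singleton u b ih =>
    obtain ⟨l, e, h⟩ := ih
    rw [← List.cons_append, h]
    cases b with
    | true => exact ⟨l, e + 1, boolWord_concat_append l e 1⟩
    | false => exact ⟨l ++ [e], 0, by rw [boolWord_append (l ++ [e])]; rfl⟩

theorem sum_runSign (a : ℕ) : ∑ b ∈ Finset.range (a + 1), runSign (a + 1 - b) = -1 := by
  rw [Finset.sum_range_succ, Finset.sum_eq_zero]
  · simp [runSign]
  · intro b hb
    rw [Finset.mem_range] at hb
    obtain ⟨k, hk⟩ : ∃ k, a + 1 - b = k + 2 := ⟨a - b - 1, by omega⟩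
    rw [hk]
    rfl

theorem conv_eq_zero {α : Type*} (K : List α → ℂ) (w : List α) :
    ∀ K₁ : List α → ℂ, (∀ u, u.length ≤ w.length → K₁ u = 0) → conv K₁ K w = 0 := by
  induction w with
  | nil => intro K₁ h; simp [conv, h]
  | cons x w ih =>
    intro K₁ h
    rw [conv, h [] (by simp), ih _ fun u hu => h _ (by simpa using hu)]
    ring

theorem conv_replicate_append {α : Type*} (x : α) (K : List α → ℂ) (v : List α) (a : ℕ) :
    ∀ K₁ : List α → ℂ, conv K₁ K (List.replicate a x ++ v) =
      ∑ b ∈ Finset.range a, K₁ (List.replicate b x) * K (List.replicate (a - b) x ++ v) +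
        conv (fun l => K₁ (List.replicate a x ++ l)) K v := by
  induction a with
  | zero => intro K₁; simp
  | succ a ih =>
    intro K₁
    rw [Finset.sum_range_succ', List.replicate_succ, List.cons_append, conv, ih]
    simp only [List.replicate_succ, List.cons_append, List.replicate_zero, Nat.sub_zero,
      Nat.add_sub_add_right]
    ring

variable {R : List Bool → ℂ} {c : ℂ} {κ : ℕ → ℂ}

theorem apply_append_comm (hcyc : ∀ x w, R (x :: w) = R (w ++ [x])) (u : List Bool) :
    ∀ v, R (u ++ v) = R (v ++ u) := by
  induction u with
  | nil => intro v; simp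
  | cons x u ih =>
    intro v
    rw [List.cons_append, hcyc, List.append_assoc, ih]
    simp

/-- Sum over the prefixes that end at a letter `X⁻¹`: these are the only ones that count, because
cyclically every other prefix has a run of two letters `X`. -/
theorem conv_boolWord (hcyc : ∀ x w, R (x :: w) = R (w ++ [x])) {N : ℕ}
    (ih : ∀ l : List ℕ, l ≠ [] → (boolWord l).length < N →
      R (boolWord l) = (l.map runSign).prod * κ l.length) (js : List ℕ) :
    ∀ (ps : List ℕ) (j : ℕ), (boolWord (ps ++ j :: js)).length + 1 < N →
      conv (fun l => R (true :: (boolWord ps ++ false :: l))) (fun l => R (false :: l))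
        (List.replicate j true ++ boolWord js) =
      -((ps ++ j :: js).map runSign).prod *
        ∑ i ∈ Finset.range (js.length + 1), κ (ps.length + 1 + i) * κ (js.length + 1 - i) := by
  -- a letter `X` in front of the word is moved to the end
  have hrot : ∀ (ps : List ℕ) (e : ℕ), (boolWord (ps ++ [e])).length + 1 < N →
      R (true :: (boolWord ps ++ false :: List.replicate e true)) =
        (ps.map runSign).prod * runSign (e + 1) * κ (ps.length + 1) := by
    intro ps e hN
    have h1 : boolWord ps ++ false :: List.replicate e true ++ [true] =
        boolWord (ps ++ [e + 1]) := by
      rw [← boolWord_concat_append ps e 1]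
      simp [boolWord]
    rw [hcyc, h1, ih _ (by simp)]
    · simp
    · rw [← h1]
      simp [boolWord] at hN ⊢
      omega
  induction js with
  | nil =>
    intro ps j hN
    have hN' : ∀ b ≤ j, (boolWord (ps ++ [b])).length + 1 < N := by
      intro b hb
      simp [boolWord] at hN ⊢
      omega
    have hj := ih [j] (by simp) (by simp [boolWord] at hN ⊢; omega)
    rw [conv_replicate_append]
    have h0 := hrot ps 0 (hN' 0 (Nat.zero_le _))
    cases j with
    | zero =>
      simp [boolWord, conv, runSign] at h0 hj ⊢
      rw [h0, hj]
      ring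
    | succ j =>
      rw [Finset.sum_range_succ', Finset.sum_eq_zero]
      · have hlast := hrot ps (j + 1) (hN' _ le_rfl)
        rw [List.replicate_zero] at h0 ⊢
        simp only [boolWord_nil, conv, List.append_nil]
        rw [hlast, h0]
        rw [boolWord_cons, boolWord_nil, List.append_nil] at hj
        rw [Nat.sub_zero, hj]
        simp [runSign]
        ring
      · intro b hb
        rw [Finset.mem_range] at hb
        rw [hrot ps (b + 1) (hN' _ (by omega))]
        simp [runSign]
  | cons j' js ihj =>
    intro ps j hN
    have hN' : ∀ b ≤ j, (boolWord (ps ++ [b])).length + 1 < N := by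
      intro b hb
      simp [boolWord] at hN ⊢
      omega
    have hj := ih (j :: j' :: js) (by simp) (by simp [boolWord] at hN ⊢; omega)
    have hrec := ihj (ps ++ [j]) j' (by simpa using hN)
    have hbw : ∀ l, boolWord (ps ++ [j]) ++ false :: l =
        boolWord ps ++ false :: (List.replicate j true ++ false :: l) := by
      intro l; simp [boolWord]
    simp only [hbw] at hrec
    rw [conv_replicate_append, boolWord_cons j', conv, hrec]
    have h0 := hrot ps 0 (hN' 0 (Nat.zero_le _))
    have hlast := hrot ps j (hN' _ le_rfl)
    rw [boolWord_cons, boolWord_cons] at hj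
    rw [Finset.sum_range_succ' _ (j' :: js).length]
    have hsum : ∑ i ∈ Finset.range (js.length + 1),
        κ ((ps ++ [j]).length + 1 + i) * κ (js.length + 1 - i) =
        ∑ i ∈ Finset.range (j' :: js).length,
        κ (ps.length + 1 + (i + 1)) * κ ((j' :: js).length + 1 - (i + 1)) := by
      refine Finset.sum_congr (by simp) fun i _ => ?_
      simp only [List.length_append, List.length_cons, List.length_nil]
      rw [Nat.add_sub_add_right]
      congr 2
      omega
    rw [hsum]
    cases j with
    | zero =>
      simp [runSign] at h0 hj ⊢
      rw [h0, hj]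
      ring
    | succ j =>
      rw [Finset.sum_range_succ', Finset.sum_eq_zero]
      · rw [List.append_nil, hlast, List.replicate_zero, Nat.sub_zero, hj]
        rw [List.replicate_zero] at h0
        rw [h0]
        simp [runSign]
        ring
      · intro b hb
        rw [Finset.mem_range] at hb
        rw [hrot ps (b + 1) (hN' _ (by omega))]
        simp [runSign]

/-- Here `R` stands for the joint cumulants. A functional on the words in `X` and `X⁻¹` that is
cyclically invariant, has the given values on powers of one letter and satisfies the contraction
rule is determined: each isolated letter `X` contributes a sign, and longer runs of `X` make it
vanish. -/
theorem apply_boolWord (hcyc : ∀ x w, R (x :: w) = R (w ++ [x]))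
    (hX : ∀ n, R (List.replicate (n + 1) true) = c + 1)
    (hY : ∀ n, R (List.replicate n false) = κ n)
    (hκ : ∀ n, c * κ (n + 1) =
      ∑ i ∈ Finset.range n, κ (i + 1) * κ (n - i) + if n = 0 then 1 else 0)
    (hcon : ∀ w, R (false :: true :: w) +
      conv (fun l => R (true :: l)) (fun l => R (false :: l)) w = emptyWord w)
    (l : List ℕ) (hl : l ≠ []) :
    R (boolWord l) = (l.map runSign).prod * κ l.length := by
  obtain ⟨N, hN⟩ : ∃ N, (boolWord l).length = N := ⟨_, rfl⟩
  induction N using Nat.strong_induction_on generalizing l with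
  | _ N ih =>
  have ih' : ∀ l : List ℕ, l ≠ [] → (boolWord l).length < N →
      R (boolWord l) = (l.map runSign).prod * κ l.length := fun l hl h => ih _ h l hl rfl
  -- it is enough to treat words that begin with `X⁻¹ X`
  have main : ∀ (a : ℕ) (js : List ℕ), (boolWord ((a + 1) :: js)).length = N →
      R (boolWord ((a + 1) :: js)) =
        (((a + 1) :: js).map runSign).prod * κ ((a + 1) :: js).length := by
    intro a js hN
    have hshort : ∀ b ≤ a, R (false :: (List.replicate b true ++ boolWord js)) =
        runSign b * ((js.map runSign).prod * κ (js.length + 1)) := by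
      intro b hb
      rw [← boolWord_cons, ih' (b :: js) (by simp)]
      · simp [mul_assoc]
      · rw [boolWord_cons] at hN ⊢
        simp at hN ⊢
        omega
    have hc := hcon (List.replicate a true ++ boolWord js)
    rw [conv_replicate_append] at hc
    have hw : boolWord ((a + 1) :: js) =
        false :: true :: (List.replicate a true ++ boolWord js) := by
      rw [boolWord_cons, List.replicate_succ, List.cons_append]
    rw [hw, eq_sub_of_add_eq hc]
    have hX' : ∀ n, R (true :: List.replicate n true) = c + 1 := fun n => by
      rw [← List.replicate_succ, hX]
    simp only [hX', ← Finset.mul_sum]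
    cases a with
    | zero =>
      simp only [List.replicate_zero, List.nil_append, Finset.range_zero, Finset.sum_empty,
        mul_zero, zero_add] at hshort ⊢
      cases js with
      | nil =>
        have h1 := hκ 0
        have h2 := hX 0
        have h3 := hY 1
        simp at h1 h2 h3
        simp [conv, runSign, h2, h3]
        linear_combination -h1
      | cons j js =>
        have h1 := conv_boolWord hcyc ih' js [] j (by
          rw [List.nil_append]; rw [boolWord_cons] at hN; simp at hN ⊢; omega)
        have h2 := hX 0
        have h3 := hκ (js.length + 1)
        have h4 := hshort 0 le_rfl
        rw [List.replicate_zero, List.nil_append] at h4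
        rw [if_neg (Nat.succ_ne_zero _), add_zero] at h3
        simp only [boolWord_nil, List.nil_append, List.length_nil, zero_add, add_comm 1] at h1
        rw [boolWord_cons, conv, h1, emptyWord_cons, ← boolWord_cons, h4, ← h3]
        rw [List.replicate_succ, List.replicate_zero] at h2
        rw [h2]
        simp [runSign]
        ring
    | succ a =>
      have hsum : ∑ b ∈ Finset.range (a + 1),
          R (false :: (List.replicate (a + 1 - b) true ++ boolWord js)) =
          -((js.map runSign).prod * κ (js.length + 1)) := by
        rw [← neg_one_mul, ← sum_runSign a, Finset.sum_mul]
        exact Finset.sum_congr rfl fun b _ => hshort _ (by omega)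
      have h0 := hshort 0 (Nat.zero_le _)
      have hconv : conv (fun l => R (true :: (List.replicate (a + 1) true ++ l)))
          (fun l => R (false :: l)) (boolWord js) =
          (c + 1) * ((js.map runSign).prod * κ (js.length + 1)) := by
        rw [List.replicate_zero, List.nil_append] at h0
        cases js with
        | nil =>
          rw [boolWord_nil] at h0 ⊢
          rw [conv, List.append_nil, hX', h0]
          simp [runSign]
        | cons j js =>
          rw [boolWord_cons] at h0 ⊢
          rw [conv, List.append_nil, hX', h0, conv_eq_zero]
          · simp [runSign]
          · intro u hu
            obtain ⟨l, e, hle⟩ := exists_boolWord u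
            have : true :: (List.replicate (a + 1) true ++ false :: u) =
                List.replicate (a + 2) true ++ boolWord (l ++ [e]) := by
              rw [hle, List.replicate_succ (n := a + 1), List.cons_append]
            rw [this, apply_append_comm hcyc, boolWord_concat_append, ih' _ (by simp)]
            · simp [runSign, ← add_assoc]
            · rw [← boolWord_concat_append, ← hle]
              rw [boolWord_cons, boolWord_cons] at hN
              simp at hu hN ⊢
              omega
      rw [hsum, hconv]
      simp [runSign, List.replicate_succ]
  by_cases hzero : ∀ i ∈ l, i = 0
  · rw [List.eq_replicate_of_mem hzero, ← hY]
    have : ∀ n, boolWord (List.replicate n 0) = List.replicate n false := by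
      intro n
      induction n with
      | zero => rfl
      | succ n ih => rw [List.replicate_succ, boolWord_cons, ih]; rfl
    rw [this]
    simp [runSign]
  · push Not at hzero
    obtain ⟨i, hi, hi0⟩ := hzero
    obtain ⟨l₁, l₂, rfl⟩ := List.append_of_mem hi
    obtain ⟨a, rfl⟩ := Nat.exists_eq_succ_of_ne_zero hi0
    have h := main a (l₂ ++ l₁) (by
      rw [← hN, ← List.cons_append, boolWord_append, boolWord_append]
      simp [Nat.add_comm])
    rw [boolWord_append, apply_append_comm hcyc, ← boolWord_append, List.cons_append, h]
    simp
    ring_nf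

end Words

/-! ### The moments of the free Poisson law -/

section Law

/-- The polynomial under the root in the density of the free Poisson law of rate `lam` and jump
size `1`. -/
def mpPoly (lam t : ℝ) : ℝ := 4 * lam - (t - 1 - lam) ^ 2

/-- The density of the free Poisson law of rate `lam` and jump size `1` on its support, written
without the cut-off outside the support. -/
noncomputable def mpDensity (lam t : ℝ) : ℝ := √(mpPoly lam t) / (2 * Real.pi * t)

/-- The left endpoint of the support of the free Poisson law of rate `lam`. -/
noncomputable def mpLeft (lam : ℝ) : ℝ := (1 - √lam) ^ 2

/-- The right endpoint of the support of the free Poisson law of rate `lam`. -/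
noncomputable def mpRight (lam : ℝ) : ℝ := (1 + √lam) ^ 2

/-- The moments of the free Poisson law, those of negative order included. -/
noncomputable def mpMoment (lam : ℝ) (k : ℤ) : ℝ :=
  ∫ t in mpLeft lam..mpRight lam, t ^ k * mpDensity lam t

variable {lam : ℝ}

theorem one_lt_sqrt_rate (hlam : 1 < lam) : 1 < √lam := by
  rw [Real.lt_sqrt zero_le_one]; simpa using hlam

theorem mpLeft_pos (hlam : 1 < lam) : 0 < mpLeft lam := by
  have := one_lt_sqrt_rate hlam
  unfold mpLeft
  nlinarith

theorem mpLeft_lt_mpRight (hlam : 1 < lam) : mpLeft lam < mpRight lam := by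
  have := one_lt_sqrt_rate hlam
  unfold mpLeft mpRight
  nlinarith

theorem mpPoly_eq (hlam : 1 < lam) (t : ℝ) :
    mpPoly lam t = (mpRight lam - t) * (t - mpLeft lam) := by
  have h := Real.sq_sqrt (zero_le_one.trans hlam.le)
  unfold mpPoly mpLeft mpRight
  linear_combination (√lam ^ 2 + lam - 2 * t - 2) * h

theorem mpLeft_mul_mpRight (hlam : 1 < lam) : mpLeft lam * mpRight lam = (lam - 1) ^ 2 := by
  have h := Real.sq_sqrt (zero_le_one.trans hlam.le)
  unfold mpLeft mpRight
  linear_combination (√lam ^ 2 + lam - 2) * h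

theorem continuous_mpPoly (lam : ℝ) : Continuous (mpPoly lam) := by
  unfold mpPoly; fun_prop

theorem continuousOn_mpDensity (hlam : 1 < lam) :
    ContinuousOn (mpDensity lam) (Set.Icc (mpLeft lam) (mpRight lam)) := by
  unfold mpDensity
  refine ContinuousOn.div ?_ (by fun_prop) fun t ht => ?_
  · exact (continuous_mpPoly lam).sqrt.continuousOn
  · have := (mpLeft_pos hlam).trans_le ht.1
    have := Real.pi_pos
    positivity

theorem mpDensity_nonneg (hlam : 1 < lam) {t : ℝ} (ht : mpLeft lam ≤ t) : 0 ≤ mpDensity lam t := by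
  have := (mpLeft_pos hlam).trans_le ht
  have := Real.pi_pos
  unfold mpDensity
  positivity

theorem integral_freePoisson (hlam : 1 < lam) (f : ℝ → ℝ) :
    ∫ t, f t ∂(freePoisson lam 1) =
      ∫ t in mpLeft lam..mpRight lam, f t * mpDensity lam t := by
  have h0 : max 0 (1 - lam) = 0 := max_eq_left (by linarith)
  have hind : freePoissonDensity lam 1 =
      (Set.Ioo (mpLeft lam) (mpRight lam)).indicator (mpDensity lam) := by
    unfold freePoissonDensity mpLeft mpRight
    simp only [one_mul]
    congr 1
    funext x
    unfold mpDensity mpPoly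
    rw [one_div, ← div_eq_inv_mul]
    congr 2
    · ring_nf
    · ring
  have hnn : ∀ t, 0 ≤ freePoissonDensity lam 1 t := by
    intro t
    rw [hind]
    exact Set.indicator_nonneg (fun t ht => mpDensity_nonneg hlam ht.1.le) t
  have hmeas : Measurable (freePoissonDensity lam 1) := by
    rw [hind]
    refine Measurable.indicator ?_ measurableSet_Ioo
    unfold mpDensity
    exact ((continuous_mpPoly lam).sqrt.measurable).div (by fun_prop)
  rw [freePoisson, h0, ENNReal.ofReal_zero, zero_smul, zero_add,
    integral_withDensity_eq_integral_toReal_smul hmeas.ennreal_ofReal (by simp)]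
  simp only [ENNReal.toReal_ofReal (hnn _), smul_eq_mul]
  rw [intervalIntegral.integral_of_le (mpLeft_lt_mpRight hlam).le,
    integral_Ioc_eq_integral_Ioo, ← integral_indicator measurableSet_Ioo]
  refine integral_congr_ae (Filter.Eventually.of_forall fun t => ?_)
  simp only [hind]
  by_cases ht : t ∈ Set.Ioo (mpLeft lam) (mpRight lam)
  · simp [ht, mul_comm]
  · simp [ht]

theorem continuousOn_zpow_mul_mpDensity (hlam : 1 < lam) (k : ℤ) :
    ContinuousOn (fun t => t ^ k * mpDensity lam t) (Set.Icc (mpLeft lam) (mpRight lam)) := by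
  refine ContinuousOn.mul ?_ (continuousOn_mpDensity hlam)
  exact continuousOn_id.zpow₀ k fun t ht => Or.inl ((mpLeft_pos hlam).trans_le ht.1).ne'

theorem intervalIntegrable_zpow_mul_mpDensity (hlam : 1 < lam) (k : ℤ) :
    IntervalIntegrable (fun t => t ^ k * mpDensity lam t) volume (mpLeft lam) (mpRight lam) := by
  refine ContinuousOn.intervalIntegrable ?_
  rw [Set.uIcc_of_le (mpLeft_lt_mpRight hlam).le]
  exact continuousOn_zpow_mul_mpDensity hlam k

/-- The three-term recursion for the moments, from integrating the derivative of
`t ^ k * Q ^ (3 / 2)`, where `Q` is the polynomial `mpPoly lam`. -/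
theorem mpMoment_three_term (hlam : 1 < lam) (k : ℤ) :
    (k + 3) * mpMoment lam (k + 2) =
      (2 * k + 3) * (1 + lam) * mpMoment lam (k + 1) - k * (lam - 1) ^ 2 * mpMoment lam k := by
  have hab := mpLeft_lt_mpRight hlam
  have hint := fun k => intervalIntegrable_zpow_mul_mpDensity hlam k
  have h0 : ∫ t in mpLeft lam..mpRight lam,
      (((k : ℝ) + 3) * (t ^ (k + 2) * mpDensity lam t) -
        (2 * k + 3) * (1 + lam) * (t ^ (k + 1) * mpDensity lam t)) +
        k * (lam - 1) ^ 2 * (t ^ k * mpDensity lam t) = 0 := by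
    rw [intervalIntegral.integral_eq_sub_of_hasDerivAt_of_le hab.le
      (f := fun t => -(2 * Real.pi)⁻¹ * (t ^ k * (mpPoly lam t * √(mpPoly lam t))))]
    · simp [mpPoly_eq hlam]
    · refine ContinuousOn.mul continuousOn_const (ContinuousOn.mul ?_ ?_)
      · exact continuousOn_id.zpow₀ k fun t ht => Or.inl ((mpLeft_pos hlam).trans_le ht.1).ne'
      · exact ((continuous_mpPoly lam).mul (continuous_mpPoly lam).sqrt).continuousOn
    · intro t ht
      have ht0 : 0 < t := (mpLeft_pos hlam).trans ht.1
      have hQ : 0 < mpPoly lam t := by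
        rw [mpPoly_eq hlam]
        exact mul_pos (sub_pos.mpr ht.2) (sub_pos.mpr ht.1)
      have hd : HasDerivAt (mpPoly lam) (-(2 * (t - 1 - lam))) t := by
        unfold mpPoly
        have := (((hasDerivAt_id t).sub_const 1).sub_const lam).pow 2
        simpa using this.const_sub (4 * lam)
      have h1 := (((hasDerivAt_zpow k t (Or.inl ht0.ne')).mul
        (hd.mul (hd.sqrt hQ.ne'))).const_mul (-(2 * Real.pi)⁻¹))
      refine h1.congr_deriv ?_
      have hs : √(mpPoly lam t) ≠ 0 := (Real.sqrt_pos.mpr hQ).ne'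
      have hsq : mpPoly lam t = √(mpPoly lam t) ^ 2 := (Real.sq_sqrt hQ.le).symm
      have hpi := Real.pi_ne_zero
      have hz2 : t ^ (k + 2) = t ^ (k - 1) * t ^ 3 := by
        rw [← zpow_natCast, ← zpow_add₀ ht0.ne']; congr 1; push_cast; ring
      have hz1 : t ^ (k + 1) = t ^ (k - 1) * t ^ 2 := by
        rw [← zpow_natCast, ← zpow_add₀ ht0.ne']; congr 1; push_cast; ring
      have hz0 : t ^ k = t ^ (k - 1) * t := by
        rw [← zpow_add_one₀ ht0.ne']; congr 1; ring
      have hdiv : mpPoly lam t * (-(2 * (t - 1 - lam)) / (2 * √(mpPoly lam t))) =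
          -(t - 1 - lam) * √(mpPoly lam t) := by
        field_simp
        rw [← hsq]
        ring
      simp only [Pi.mul_apply]
      rw [hdiv, hz2, hz1, hz0]
      unfold mpDensity
      generalize √(mpPoly lam t) = s
      unfold mpPoly
      field_simp
      ring
    · exact (((hint _).const_mul _).sub ((hint _).const_mul _)).add ((hint _).const_mul _)
  rw [intervalIntegral.integral_add (((hint _).const_mul _).sub ((hint _).const_mul _))
    ((hint _).const_mul _), intervalIntegral.integral_sub ((hint _).const_mul _)
    ((hint _).const_mul _), intervalIntegral.integral_const_mul,
    intervalIntegral.integral_const_mul, intervalIntegral.integral_const_mul] at h0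
  unfold mpMoment
  linear_combination h0

/-- The first moment, by rescaling the area of a half-disc. -/
theorem mpMoment_one (hlam : 1 < lam) : mpMoment lam 1 = lam := by
  have hl : 0 < lam := zero_lt_one.trans hlam
  have hsq := Real.sq_sqrt hl.le
  have hs : 0 < √lam := Real.sqrt_pos.mpr hl
  have h1 : mpMoment lam 1 =
      ∫ t in mpLeft lam..mpRight lam, (2 * Real.pi)⁻¹ * √(mpPoly lam t) := by
    refine intervalIntegral.integral_congr fun t ht => ?_
    rw [Set.uIcc_of_le (mpLeft_lt_mpRight hlam).le] at ht
    have ht0 : t ≠ 0 := ((mpLeft_pos hlam).trans_le ht.1).ne'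
    have := Real.pi_ne_zero
    simp only [zpow_one, mpDensity]
    field_simp
  have h2 := intervalIntegral.integral_comp_mul_add (a := -1) (b := 1)
    (fun t => √(mpPoly lam t)) (c := 2 * √lam) (by positivity) (1 + lam)
  have hl' : 2 * √lam * -1 + (1 + lam) = mpLeft lam := by
    unfold mpLeft; linear_combination -hsq
  have hr' : 2 * √lam * 1 + (1 + lam) = mpRight lam := by
    unfold mpRight; linear_combination -hsq
  have h3 : ∀ u : ℝ, √(mpPoly lam (2 * √lam * u + (1 + lam))) = 2 * √lam * √(1 - u ^ 2) := by
    intro u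
    have : mpPoly lam (2 * √lam * u + (1 + lam)) = (2 * √lam) ^ 2 * (1 - u ^ 2) := by
      unfold mpPoly; linear_combination -4 * hsq
    rw [this, Real.sqrt_mul (by positivity), Real.sqrt_sq (by positivity)]
  simp only [h3, hl', hr'] at h2
  rw [intervalIntegral.integral_const_mul, integral_sqrt_one_sub_sq, smul_eq_mul] at h2
  have hpi := Real.pi_ne_zero
  rw [h1, intervalIntegral.integral_const_mul]
  have h4 : ∫ t in mpLeft lam..mpRight lam, √(mpPoly lam t) = 2 * lam * Real.pi := by
    field_simp at h2
    linear_combination -h2 + 2 * Real.pi * hsq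
  rw [h4]
  field_simp

/-- The substitution `t ↦ (lam - 1) ^ 2 / t`, which exchanges the endpoints of the support,
expresses the moments of negative order by those of nonnegative order. -/
theorem mpMoment_neg (hlam : 1 < lam) (k : ℤ) :
    mpMoment lam (-k) = (lam - 1) ^ (1 - 2 * k) * mpMoment lam (k - 1) := by
  have hab := mpLeft_lt_mpRight hlam
  have ha := mpLeft_pos hlam
  have hb := ha.trans hab
  have hc : 0 < lam - 1 := sub_pos.mpr hlam
  have hprod := mpLeft_mul_mpRight hlam
  have hpos : ∀ x ∈ Set.uIcc (mpLeft lam) (mpRight lam), 0 < x := fun x hx => by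
    rw [Set.uIcc_of_le hab.le] at hx
    exact ha.trans_le hx.1
  have h := intervalIntegral.integral_comp_mul_deriv' (a := mpLeft lam) (b := mpRight lam)
    (f := fun x => (lam - 1) ^ 2 / x) (f' := fun x => -((lam - 1) ^ 2 / x ^ 2))
    (g := fun t => t ^ (-k) * mpDensity lam t) ?_ ?_ ?_
  · have hfa : (lam - 1) ^ 2 / mpLeft lam = mpRight lam := by
      rw [← hprod]; field_simp
    have hfb : (lam - 1) ^ 2 / mpRight lam = mpLeft lam := by
      rw [← hprod]; field_simp
    simp only [hfa, hfb] at h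
    rw [intervalIntegral.integral_symm (mpLeft lam) (mpRight lam), ← neg_eq_iff_eq_neg] at h
    unfold mpMoment
    rw [← h, ← intervalIntegral.integral_neg, ← intervalIntegral.integral_const_mul]
    refine intervalIntegral.integral_congr fun x hx => ?_
    have hx0 := hpos x hx
    have hQ : mpPoly lam ((lam - 1) ^ 2 / x) = ((lam - 1) / x) ^ 2 * mpPoly lam x := by
      unfold mpPoly; field_simp; ring
    simp only [Function.comp, mpDensity]
    rw [hQ, Real.sqrt_mul (by positivity), Real.sqrt_sq (by positivity), div_zpow,
      ← zpow_natCast, ← zpow_mul]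
    have hz1 : (lam - 1) ^ (1 - 2 * k) = (lam - 1) ^ (((2 : ℕ) : ℤ) * -k) * (lam - 1) := by
      rw [← zpow_add_one₀ hc.ne']; congr 1; push_cast; ring
    have hz2 : x ^ (k - 1) = x ^ k / x := by rw [zpow_sub_one₀ hx0.ne']; rfl
    have hz3 : x ^ (-k) = (x ^ k)⁻¹ := zpow_neg _ _
    rw [hz1, hz2, hz3]
    have hxk : x ^ k ≠ 0 := zpow_ne_zero _ hx0.ne'
    have := Real.pi_ne_zero
    push_cast
    field_simp
  · intro x hx
    have hx0 := hpos x hx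
    have := ((hasDerivAt_inv hx0.ne').const_mul ((lam - 1) ^ 2))
    simpa [div_eq_mul_inv] using this
  · refine ContinuousOn.neg (continuousOn_const.div (by fun_prop) fun x hx => ?_)
    have := hpos x hx
    positivity
  · have : (fun x => (lam - 1) ^ 2 / x) '' Set.uIcc (mpLeft lam) (mpRight lam) ⊆
        Set.Icc (mpLeft lam) (mpRight lam) := by
      rintro _ ⟨x, hx, rfl⟩
      have hx0 := hpos x hx
      rw [Set.uIcc_of_le hab.le] at hx
      simp only
      rw [← hprod]
      constructor
      · rw [le_div_iff₀ hx0]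
        exact mul_le_mul_of_nonneg_left hx.2 ha.le
      · rw [div_le_iff₀ hx0, mul_comm]
        exact mul_le_mul_of_nonneg_left hx.1 hb.le
    exact (continuousOn_zpow_mul_mpDensity hlam (-k)).mono this

/-- The free Poisson law of rate greater than `1` has total mass `1`. -/
theorem mpMoment_zero (hlam : 1 < lam) : mpMoment lam 0 = 1 := by
  have hc : 0 < lam - 1 := sub_pos.mpr hlam
  have h1 := mpMoment_three_term hlam (-1)
  have h2 := mpMoment_neg hlam 1
  norm_num at h1 h2
  rw [mpMoment_one hlam, h2] at h1
  field_simp at h1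
  have : lam * (mpMoment lam 0 - 1) = 0 := by linarith
  rcases mul_eq_zero.mp this with h | h <;> linarith

end Law

section Recursion

open PowerSeries

/-- The three-term recursion makes the generating series algebraic: `T = 1 - c X - 2 X F` satisfies
a first order differential equation that is also satisfied by a square root of
`D = (1 - c X)² - 4 X`. -/
theorem quadratic_recursion_of_three_term (c : ℝ) (m : ℕ → ℝ) (h0 : m 0 = 1) (h1 : m 1 = c + 1)
    (h : ∀ k : ℕ, ((k : ℝ) + 3) * m (k + 2) =
      (2 * k + 3) * (c + 2) * m (k + 1) - k * c ^ 2 * m k) (n : ℕ) :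
    m (n + 1) = ∑ i ∈ Finset.range (n + 1), m i * m (n - i) + c * m n := by
  let F : ℝ⟦X⟧ := PowerSeries.mk m
  let T : ℝ⟦X⟧ := 1 - c • X - (2 : ℝ) • (X * F)
  let D : ℝ⟦X⟧ := 1 - (2 * (c + 2)) • X + (c ^ 2) • X ^ 2
  have hC2 : C (2 : ℝ) = 2 := map_ofNat C 2
  have hC4 : C (4 : ℝ) = 4 := map_ofNat C 4
  have hT0 : coeff 0 T = 1 := by simp [T]
  have hT1 : coeff 1 T = -(c + 2) := by
    simp [T, F, coeff_one, h0, coeff_succ_X_mul (R := ℝ) 0]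
    ring
  have hT : ∀ n, coeff (n + 2) T = -2 * m (n + 1) := by
    intro n
    simp [T, F, coeff_one, coeff_X, coeff_succ_X_mul]
  have hD' : d⁄dX ℝ D = (2 * c ^ 2) • X - (2 * (c + 2)) • 1 := by
    simp only [D, map_add, map_sub, Derivation.map_smul, Derivation.map_one_eq_zero, derivative_X,
      Derivation.leibniz_pow, pow_one, smul_eq_mul, mul_one, Nat.add_one_sub_one]
    module
  have hode : (2 : ℝ) • (D * d⁄dX ℝ T) = d⁄dX ℝ D * T := by
    have hl : D * d⁄dX ℝ T = d⁄dX ℝ T - (2 * (c + 2)) • (X * d⁄dX ℝ T) +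
        (c ^ 2) • (X ^ 2 * d⁄dX ℝ T) := by
      simp only [D, add_mul, sub_mul, one_mul, smul_mul_assoc]
    have hr : d⁄dX ℝ D * T = (2 * c ^ 2) • (X * T) - (2 * (c + 2)) • T := by
      rw [hD']
      simp only [sub_mul, one_mul, smul_mul_assoc]
    rw [hl, hr]
    ext n
    rcases n with _ | _ | n
    · simp only [map_add, map_sub, coeff_smul, coeff_zero_X_mul, coeff_derivative, smul_eq_mul,
        pow_two, mul_assoc]
      simp only [zero_add, hT1, hT0]
      push_cast
      ring
    · simp only [map_add, map_sub, coeff_smul, coeff_succ_X_mul, coeff_derivative, smul_eq_mul,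
        pow_two, mul_assoc, coeff_zero_X_mul, zero_add]
      simp only [hT 0, hT1, hT0, h1]
      push_cast
      ring
    · simp only [map_add, map_sub, coeff_smul, coeff_succ_X_mul, coeff_derivative, smul_eq_mul,
        pow_two, mul_assoc]
      rcases n with _ | n
      · have := h 0
        simp only [zero_add, hT 0, hT1, hT 1, h1] at this ⊢
        push_cast at this ⊢
        linarith
      · have := h (n + 1)
        simp only [hT] at this ⊢
        push_cast at this ⊢
        linarith
  have hD0 : constantCoeff D = 1 := by simp [D]
  have hDne : constantCoeff D ≠ 0 := by rw [hD0]; exact one_ne_zero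
  have hDD : D * D⁻¹ = 1 := PowerSeries.mul_inv_cancel D hDne
  have hT0' : constantCoeff T = 1 := by rw [← coeff_zero_eq_constantCoeff_apply, hT0]
  have hTD : T ^ 2 = D := by
    have hV : T ^ 2 * D⁻¹ = 1 := by
      refine derivative.ext ?_ (by simp [hT0', hD0])
      rw [Derivation.leibniz, Derivation.map_one_eq_zero, derivative_inv', Derivation.leibniz_pow]
      simp only [smul_eq_mul, nsmul_eq_mul]
      have h2 : (2 : ℝ) • (D * d⁄dX ℝ T) = 2 * (D * d⁄dX ℝ T) := by
        rw [two_smul, two_mul]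
      rw [h2] at hode
      push_cast
      linear_combination (T * D⁻¹ ^ 2) * hode - 2 * D⁻¹ * T * d⁄dX ℝ T * hDD
    calc T ^ 2 = T ^ 2 * D⁻¹ * D := by rw [mul_assoc, mul_comm D⁻¹, hDD, mul_one]
      _ = D := by rw [hV, one_mul]
  have hF : F = 1 + X * (F * F) + c • (X * F) := by
    have h4 : (4 : ℝ⟦X⟧) * X ≠ 0 := mul_ne_zero (by
      rw [← hC4, Ne, map_eq_zero_iff _ C_injective]; norm_num) X_ne_zero
    refine mul_left_cancel₀ h4 ?_
    have e1 : T = 1 - C c * X - 2 * (X * F) := by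
      simp only [T, smul_eq_C_mul, hC2]
    have e2 : D = 1 - 2 * (C c + 2) * X + C c ^ 2 * X ^ 2 := by
      simp only [D, smul_eq_C_mul, map_mul, map_add, map_pow, hC2]
    rw [e1, e2] at hTD
    rw [smul_eq_C_mul]
    linear_combination -hTD
  have := congrArg (coeff (n + 1)) hF
  rw [map_add, map_add, coeff_smul, coeff_succ_X_mul, coeff_succ_X_mul, coeff_mul,
    Finset.Nat.sum_antidiagonal_eq_sum_range_succ_mk] at this
  simpa [F, coeff_one] using this

end Recursion

section Law

variable {lam : ℝ}

theorem mpMoment_recursion (hlam : 1 < lam) (n : ℕ) :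
    mpMoment lam ((n + 1 : ℕ) : ℤ) = ∑ i ∈ Finset.range (n + 1),
      mpMoment lam (i : ℤ) * mpMoment lam ((n - i : ℕ) : ℤ) +
        (lam - 1) * mpMoment lam (n : ℤ) := by
  refine quadratic_recursion_of_three_term (lam - 1) (fun n => mpMoment lam (n : ℤ)) ?_ ?_ ?_ n
  · simpa using mpMoment_zero hlam
  · simpa using mpMoment_one hlam
  · intro k
    have := mpMoment_three_term hlam k
    push_cast at this ⊢
    linear_combination this

theorem mpMoment_neg_recursion (hlam : 1 < lam) (n : ℕ) :
    (lam - 1) * mpMoment lam (-((n + 1 : ℕ) : ℤ)) =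
      ∑ i ∈ Finset.range n, mpMoment lam (-((i + 1 : ℕ) : ℤ)) * mpMoment lam (-((n - i : ℕ) : ℤ)) +
        mpMoment lam (-(n : ℤ)) := by
  have hc : lam - 1 ≠ 0 := (sub_pos.mpr hlam).ne'
  have hneg : ∀ k : ℕ, mpMoment lam (-((k + 1 : ℕ) : ℤ)) =
      (lam - 1) * ((lam - 1) ^ (2 * (k + 1)))⁻¹ * mpMoment lam (k : ℤ) := by
    intro k
    rw [mpMoment_neg hlam, zpow_sub₀ hc, zpow_one]
    rw [div_eq_mul_inv, ← zpow_natCast]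
    congr 2
    push_cast
    ring
  cases n with
  | zero =>
    rw [hneg]
    simp [mpMoment_zero hlam]
    field_simp
  | succ p =>
    have hsum : ∑ i ∈ Finset.range (p + 1),
        mpMoment lam (-((i + 1 : ℕ) : ℤ)) * mpMoment lam (-((p + 1 - i : ℕ) : ℤ)) =
        ((lam - 1) ^ (2 * (p + 1)))⁻¹ * ∑ i ∈ Finset.range (p + 1),
          mpMoment lam (i : ℤ) * mpMoment lam ((p - i : ℕ) : ℤ) := by
      rw [Finset.mul_sum]
      refine Finset.sum_congr rfl fun i hi => ?_
      rw [Finset.mem_range] at hi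
      have h1 : p + 1 - i = p - i + 1 := by omega
      have h2 : 2 * (p + 1) + 2 = 2 * (i + 1) + 2 * (p - i + 1) := by omega
      have h3 : (lam - 1) ^ (2 * (p + 1)) * (lam - 1) ^ 2 =
          (lam - 1) ^ (2 * (i + 1)) * (lam - 1) ^ (2 * (p - i + 1)) := by
        rw [← pow_add, ← pow_add, h2]
      rw [h1, hneg, hneg]
      have h4 := pow_ne_zero (2 * (i + 1)) hc
      have h5 := pow_ne_zero (2 * (p - i + 1)) hc
      have h6 := pow_ne_zero (2 * (p + 1)) hc
      generalize (lam - 1) ^ (2 * (i + 1)) = u at *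
      generalize (lam - 1) ^ (2 * (p - i + 1)) = v at *
      generalize (lam - 1) ^ (2 * (p + 1)) = w at *
      generalize mpMoment lam (i : ℤ) = y
      generalize mpMoment lam ((p - i : ℕ) : ℤ) = z
      field_simp
      linear_combination (y * z) * h3
    rw [hsum, hneg, hneg, mpMoment_recursion hlam p, show 2 * (p + 1 + 1) = 2 * (p + 1) + 2 by ring,
      pow_add]
    field_simp

end Law

/-! ### From moments to the variable: inverse moments and invertibility -/

section State

open scoped ComplexOrder
open Polynomial

theorem integral_mul_mpDensity_mono {lam : ℝ} (hlam : 1 < lam) {f g : ℝ → ℝ}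
    (hf : ContinuousOn f (Set.Icc (mpLeft lam) (mpRight lam)))
    (hg : ContinuousOn g (Set.Icc (mpLeft lam) (mpRight lam)))
    (h : ∀ t ∈ Set.Icc (mpLeft lam) (mpRight lam), f t ≤ g t) :
    ∫ t in mpLeft lam..mpRight lam, f t * mpDensity lam t ≤
      ∫ t in mpLeft lam..mpRight lam, g t * mpDensity lam t := by
  have hab := (mpLeft_lt_mpRight hlam).le
  refine intervalIntegral.integral_mono_on hab ?_ ?_ fun t ht =>
    mul_le_mul_of_nonneg_right (h t ht) (mpDensity_nonneg hlam ht.1)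
  · refine ContinuousOn.intervalIntegrable ?_
    rw [Set.uIcc_of_le hab]
    exact hf.mul (continuousOn_mpDensity hlam)
  · refine ContinuousOn.intervalIntegrable ?_
    rw [Set.uIcc_of_le hab]
    exact hg.mul (continuousOn_mpDensity hlam)

theorem integral_const_mul_mpDensity {lam : ℝ} (hlam : 1 < lam) (c : ℝ) :
    ∫ t in mpLeft lam..mpRight lam, c * mpDensity lam t = c := by
  have h := mpMoment_zero hlam
  simp only [mpMoment, zpow_zero, one_mul] at h
  rw [intervalIntegral.integral_const_mul, h, mul_one]

theorem abs_integral_sub_le {lam : ℝ} (hlam : 1 < lam) {f g : ℝ → ℝ}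
    (hf : ContinuousOn f (Set.Icc (mpLeft lam) (mpRight lam)))
    (hg : ContinuousOn g (Set.Icc (mpLeft lam) (mpRight lam))) {δ : ℝ}
    (h : ∀ t ∈ Set.Icc (mpLeft lam) (mpRight lam), |f t - g t| ≤ δ) :
    |(∫ t in mpLeft lam..mpRight lam, f t * mpDensity lam t) -
      ∫ t in mpLeft lam..mpRight lam, g t * mpDensity lam t| ≤ δ := by
  have hab := (mpLeft_lt_mpRight hlam).le
  have hi : ∀ {f : ℝ → ℝ}, ContinuousOn f (Set.Icc (mpLeft lam) (mpRight lam)) →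
      IntervalIntegrable (fun t => f t * mpDensity lam t) volume (mpLeft lam) (mpRight lam) := by
    intro f hf
    refine ContinuousOn.intervalIntegrable ?_
    rw [Set.uIcc_of_le hab]
    exact hf.mul (continuousOn_mpDensity hlam)
  rw [← intervalIntegral.integral_sub (hi hf) (hi hg)]
  simp only [← sub_mul]
  rw [abs_le]
  constructor
  · rw [← integral_const_mul_mpDensity hlam (-δ)]
    exact integral_mul_mpDensity_mono hlam continuousOn_const (hf.sub hg)
      fun t ht => (abs_le.mp (h t ht)).1
  · conv_rhs => rw [← integral_const_mul_mpDensity hlam δ]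
    exact integral_mul_mpDensity_mono hlam (hf.sub hg) continuousOn_const
      fun t ht => (abs_le.mp (h t ht)).2

theorem map_real_smul {A : Type*} [Ring A] [Algebra ℂ A] (φ : A →ₗ[ℂ] ℂ) (r : ℝ) (a : A) :
    φ (r • a) = (r : ℂ) * φ a := by
  rw [← Complex.coe_smul, map_smul, smul_eq_mul]

variable {A : Type*} [Ring A] [StarRing A] [Algebra ℂ A]

theorem moment_aeval {φ : A →ₗ[ℂ] ℂ} (hφ : IsState φ) {X : A} {lam : ℝ} (hlam : 1 < lam)
    (hX : IsFreePoisson φ X lam 1) (p : ℝ[X]) :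
    φ (aeval X p) = ((∫ t in mpLeft lam..mpRight lam, p.eval t * mpDensity lam t : ℝ) : ℂ) := by
  have hab := (mpLeft_lt_mpRight hlam).le
  induction p using Polynomial.induction_on' with
  | add p q hp hq =>
    have hi : ∀ p : ℝ[X], IntervalIntegrable (fun t => p.eval t * mpDensity lam t) volume
        (mpLeft lam) (mpRight lam) := by
      intro p
      refine ContinuousOn.intervalIntegrable ?_
      rw [Set.uIcc_of_le hab]
      exact p.continuous.continuousOn.mul (continuousOn_mpDensity hlam)
    simp only [map_add, hp, hq, eval_add, add_mul]
    rw [intervalIntegral.integral_add (hi p) (hi q), Complex.ofReal_add]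
  | monomial n r =>
    rw [aeval_monomial, ← Algebra.smul_def, map_real_smul]
    simp only [eval_monomial, mul_assoc]
    rw [intervalIntegral.integral_const_mul, Complex.ofReal_mul]
    congr 1
    rcases Nat.eq_zero_or_pos n with rfl | hn
    · have h := integral_const_mul_mpDensity hlam 1
      simp only [pow_zero, h, hφ.map_one, Complex.ofReal_one]
    · rw [hX.moment n hn, integral_freePoisson hlam]

theorem moment_pow {φ : A →ₗ[ℂ] ℂ} (hφ : IsState φ) {X : A} {lam : ℝ} (hlam : 1 < lam)
    (hX : IsFreePoisson φ X lam 1) (n : ℕ) : φ (X ^ n) = (mpMoment lam (n : ℤ) : ℂ) := by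
  have := moment_aeval hφ hlam hX (Polynomial.X ^ n)
  simpa [mpMoment] using this

theorem im_eq_zero_of_isSelfAdjoint {φ : A →ₗ[ℂ] ℂ} (hφ : IsState φ) {a : A}
    (ha : IsSelfAdjoint a) : (φ a).im = 0 := by
  have h1 := (Complex.nonneg_iff.mp (hφ.nonneg a)).2
  have h2 := (Complex.nonneg_iff.mp (hφ.nonneg (1 + a))).2
  rw [ha.star_eq] at h1
  have h3 : star (1 + a) * (1 + a) = 1 + (a + a) + a * a := by
    rw [star_add, star_one, ha.star_eq]; noncomm_ring
  rw [h3, map_add, map_add, map_add, hφ.map_one] at h2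
  simp only [Complex.add_im, Complex.one_im] at h2
  linarith

theorem cauchy_schwarz [StarModule ℂ A] {φ : A →ₗ[ℂ] ℂ} (hφ : IsState φ) {a b : A}
    (ha : IsSelfAdjoint a) (hb : IsSelfAdjoint b) (hab : Commute a b) :
    (φ (a * b)).re ^ 2 ≤ (φ (a * a)).re * (φ (b * b)).re := by
  have key : ∀ s : ℝ, 0 ≤ (φ (b * b)).re * (s * s) + (2 * (φ (a * b)).re) * s +
      (φ (a * a)).re := by
    intro s
    have h := (Complex.nonneg_iff.mp (hφ.nonneg (a + (s : ℂ) • b))).1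
    have h3 : star (a + (s : ℂ) • b) * (a + (s : ℂ) • b) =
        a * a + (s : ℂ) • (a * b + a * b) + (s : ℂ) • (s : ℂ) • (b * b) := by
      rw [star_add, star_smul, ha.star_eq, hb.star_eq, Complex.star_def, Complex.conj_ofReal,
        add_mul, mul_add, mul_add, smul_mul_assoc, mul_smul_comm, smul_mul_assoc, mul_smul_comm,
        ← hab.eq, smul_add]
      abel
    rw [h3] at h
    simp only [map_add, map_smul, smul_eq_mul, Complex.add_re, Complex.re_ofReal_mul] at h
    linarith
  have := discrim_le_zero key
  unfold discrim at this
  linarith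

/-- The moments of the inverse are the moments of negative order of the law: `t ^ (-k)` is
uniformly close on the support to a polynomial `p`, and by the Cauchy-Schwarz inequality
`φ (X ^ (-k) * (X ^ k * p X - 1))` is small. -/
theorem moment_inv_pow [StarModule ℂ A] {φ : A →ₗ[ℂ] ℂ} (hφ : IsState φ) {X : Aˣ} {lam : ℝ}
    (hlam : 1 < lam) (hX : IsFreePoisson φ (X : A) lam 1) (k : ℕ) :
    φ ((↑X⁻¹ : A) ^ k) = (mpMoment lam (-(k : ℤ)) : ℂ) := by
  have ha := mpLeft_pos hlam
  have hXs : star (X : A) = X := hX.isSelfAdjoint.star_eq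
  have hinv : IsSelfAdjoint (↑X⁻¹ : A) := by
    have h : star (↑X⁻¹ : A) * X = 1 := by
      rw [← hXs, ← star_mul, Units.mul_inv, star_one]
    exact left_inv_eq_right_inv h (Units.mul_inv X)
  set Z : A := (↑X⁻¹ : A) ^ k with hZ
  have hZs : IsSelfAdjoint Z := hinv.pow k
  have hZX : Z * (X : A) ^ k = 1 := by
    rw [hZ, ← Units.val_pow_eq_pow_val, ← Units.val_pow_eq_pow_val, ← Units.val_mul, inv_pow,
      inv_mul_cancel, Units.val_one]
  have haeval : ∀ p : ℝ[X], IsSelfAdjoint (aeval (X : A) p) ∧ Commute Z (aeval (X : A) p) := by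
    intro p
    have hc : Commute Z (X : A) := by
      have : Commute (↑X⁻¹ : A) (X : A) := by
        rw [commute_iff_eq, Units.inv_mul, Units.mul_inv]
      exact this.pow_left k
    induction p using Polynomial.induction_on' with
    | add p q hp hq =>
      rw [map_add]
      exact ⟨hp.1.add hq.1, hp.2.add_right hq.2⟩
    | monomial n r =>
      rw [aeval_monomial, ← Algebra.smul_def, ← Complex.coe_smul]
      refine ⟨?_, (hc.pow_right n).smul_right _⟩
      have h1 : IsSelfAdjoint ((r : ℂ)) := Complex.conj_ofReal r
      exact h1.smul (hX.isSelfAdjoint.pow n)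
  set C : ℝ := (φ (Z * Z)).re with hC
  set b : ℝ := mpRight lam with hb
  have hb0 : 0 < b := ha.trans (mpLeft_lt_mpRight hlam)
  have hzc := continuousOn_id.zpow₀ (-(k : ℤ)) (f := fun t : ℝ => t)
    (s := Set.Icc (mpLeft lam) b) fun t ht => Or.inl (ha.trans_le ht.1).ne'
  have hbound : ∀ δ : ℝ, 0 < δ →
      |(φ Z).re - mpMoment lam (-(k : ℤ))| ≤ (√C * b ^ k + 1) * δ := by
    intro δ hδ
    obtain ⟨p, hp⟩ := exists_polynomial_near_of_continuousOn (mpLeft lam) b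
      (fun t => t ^ (-(k : ℤ))) hzc δ hδ
    set q : ℝ[X] := Polynomial.X ^ k * p - 1 with hq
    have hZq : Z * aeval (X : A) q = aeval (X : A) p - Z := by
      rw [hq, map_sub, map_mul, map_pow, aeval_X, map_one, mul_sub, ← mul_assoc, hZX, one_mul,
        mul_one]
    have hcs := cauchy_schwarz hφ hZs (haeval q).1 (haeval q).2
    rw [hZq, ← map_mul, moment_aeval hφ hlam hX (q * q), map_sub, moment_aeval hφ hlam hX p,
      Complex.ofReal_re, Complex.sub_re, Complex.ofReal_re] at hcs
    have hqq : ∫ t in mpLeft lam..b, (q * q).eval t * mpDensity lam t ≤ (b ^ k * δ) ^ 2 := by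
      rw [← integral_const_mul_mpDensity hlam ((b ^ k * δ) ^ 2)]
      refine integral_mul_mpDensity_mono hlam (Polynomial.continuous _).continuousOn
        continuousOn_const fun t ht => ?_
      have ht0 : 0 < t := ha.trans_le ht.1
      have h1 : q.eval t = t ^ k * (p.eval t - t ^ (-(k : ℤ))) := by
        have : t ^ k * t ^ (-(k : ℤ)) = 1 := by
          rw [zpow_neg, zpow_natCast]; field_simp
        simp only [hq, eval_sub, eval_mul, eval_pow, eval_X, eval_one]
        linear_combination this
      have h2 : |q.eval t| ≤ b ^ k * δ := by
        rw [h1, abs_mul, abs_of_pos (pow_pos ht0 k)]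
        exact mul_le_mul (pow_le_pow_left₀ ht0.le ht.2 k) (hp t ht).le (abs_nonneg _)
          (pow_pos hb0 k).le
      rw [eval_mul, ← pow_two]
      exact sq_le_sq' (abs_le.mp h2).1 (abs_le.mp h2).2
    have hC0 : 0 ≤ C := by
      have := (Complex.nonneg_iff.mp (hφ.nonneg Z)).1
      rwa [hZs.star_eq] at this
    have h3 := Real.abs_le_sqrt (hcs.trans (mul_le_mul_of_nonneg_left hqq hC0))
    rw [Real.sqrt_mul hC0, Real.sqrt_sq (by positivity)] at h3
    have h4 := abs_integral_sub_le hlam p.continuous.continuousOn hzc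
      fun t ht => (hp t ht).le
    change |_ - mpMoment lam (-(k : ℤ))| ≤ δ at h4
    rw [abs_sub_comm] at h3
    calc |(φ Z).re - mpMoment lam (-(k : ℤ))| ≤ _ := abs_sub_le _ _ _
      _ ≤ √C * (b ^ k * δ) + δ := add_le_add h3 h4
      _ = (√C * b ^ k + 1) * δ := by ring
  have hre : (φ Z).re = mpMoment lam (-(k : ℤ)) := by
    have hK : 0 < √C * b ^ k + 1 := by positivity
    refine sub_eq_zero.mp (abs_nonpos_iff.mp (le_of_forall_pos_le_add fun ε hε => ?_))
    have := hbound (ε / (√C * b ^ k + 1)) (div_pos hε hK)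
    rwa [mul_div_cancel₀ _ hK.ne', ← zero_add ε] at this
  exact Complex.ext hre (im_eq_zero_of_isSelfAdjoint hφ hZs)

end State

section CStar

open scoped ComplexOrder
open Polynomial

/-- In a `C⋆`-algebra with a faithful state the spectrum of `X` is contained in the support of its
distribution, so that it does not contain `0`. -/
theorem isUnit_of_isFreePoisson {A : Type*} [CStarAlgebra A] {φ : A →ₗ[ℂ] ℂ} (hφ : IsState φ)
    (hfaith : IsFaithful φ) {X : A} {lam : ℝ} (hlam : 1 < lam)
    (hX : IsFreePoisson φ X lam 1) : IsUnit X := by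
  by_contra hunit
  have hsa := hX.isSelfAdjoint
  have h0 : (0 : ℝ) ∈ spectrum ℝ X := spectrum.zero_mem_iff ℝ |>.mpr hunit
  set a := mpLeft lam with ha
  have ha0 : 0 < a := mpLeft_pos hlam
  -- a function that vanishes on the support of the law, but not at `0`
  set f : ℝ → ℝ := fun t => max 0 (a - t) with hf
  have hfc : Continuous f := by fun_prop
  set e := cfc f X with he
  have hes : IsSelfAdjoint e := cfc_predicate f X
  obtain ⟨r, hr⟩ := (spectrum.isCompact (𝕜 := ℝ) X).isBounded.subset_closedBall 0
  set R := max r (mpRight lam) with hR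
  have hspec : spectrum ℝ X ⊆ Set.Icc (-R) R := by
    intro t ht
    have h1 := hr ht
    rw [Metric.mem_closedBall, dist_zero_right, Real.norm_eq_abs, abs_le] at h1
    have h2 : r ≤ R := le_max_left _ _
    exact ⟨by linarith, by linarith⟩
  have hsupp : Set.Icc a (mpRight lam) ⊆ Set.Icc (-R) R := by
    intro t ht
    have h2 : mpRight lam ≤ R := le_max_right _ _
    have h3 := ht.1.trans ht.2
    exact ⟨by linarith [ht.1], ht.2.trans h2⟩
  have hsmall : ∀ ε : ℝ, 0 < ε → (φ (star e * e)).re ≤ 2 * ε := by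
    intro ε hε
    obtain ⟨p, hp⟩ := exists_polynomial_near_of_continuousOn (-R) R (fun t => f t ^ 2)
      (by fun_prop) ε hε
    have hpc : Continuous fun t => p.eval t := p.continuous
    set g : ℝ → ℝ := fun t => √(p.eval t + ε - f t ^ 2) with hg
    have hgc : Continuous g := by fun_prop
    have hgs : IsSelfAdjoint (cfc g X) := cfc_predicate g X
    have hgg : star (cfc g X) * cfc g X = aeval X p + algebraMap ℝ A ε - star e * e := by
      rw [hgs.star_eq, hes.star_eq, he, ← cfc_mul g g X, ← cfc_mul f f X, ← cfc_polynomial p X,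
        ← cfc_add_const ε _ X, ← cfc_sub _ _ X]
      refine cfc_congr fun t ht => ?_
      have := (abs_lt.mp (hp t (hspec ht))).1
      simp only [hg]
      rw [Real.mul_self_sqrt (by linarith)]
      ring
    have hpos := (Complex.nonneg_iff.mp (hφ.nonneg (cfc g X))).1
    rw [hgg, map_sub, map_add, Algebra.algebraMap_eq_smul_one, map_real_smul, hφ.map_one,
      moment_aeval hφ hlam hX p] at hpos
    simp only [Complex.sub_re, Complex.add_re, Complex.ofReal_re, mul_one] at hpos
    have hint : ∫ t in mpLeft lam..mpRight lam, p.eval t * mpDensity lam t ≤ ε := by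
      conv_rhs => rw [← integral_const_mul_mpDensity hlam ε]
      refine integral_mul_mpDensity_mono hlam hpc.continuousOn continuousOn_const fun t ht => ?_
      have h1 := (abs_lt.mp (hp t (hsupp ht))).2
      have h2 : f t = 0 := max_eq_left (by linarith [ht.1])
      rw [h2] at h1
      linarith
    linarith
  have hzero : φ (star e * e) = 0 := by
    obtain ⟨h1, h2⟩ := Complex.nonneg_iff.mp (hφ.nonneg e)
    refine Complex.ext (le_antisymm (le_of_forall_pos_le_add fun ε hε => ?_) h1) h2.symm
    have := hsmall (ε / 2) (by positivity)
    simp only [Complex.zero_re]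
    linarith
  have he0 : e = 0 := hfaith e hzero
  have hmem : f 0 ∈ spectrum ℝ e := by
    rw [he, cfc_map_spectrum f X]
    exact ⟨0, h0, rfl⟩
  have hne : Nontrivial A := by
    refine ⟨⟨1, 0, fun h => ?_⟩⟩
    have := hφ.map_one
    rw [h, map_zero] at this
    exact zero_ne_one this
  rw [he0, spectrum.zero_eq, Set.mem_singleton_iff] at hmem
  simp only [hf, sub_zero] at hmem
  rw [max_eq_right ha0.le] at hmem
  exact ha0.ne' hmem

end CStar

/-! ### Joint cumulants of the free Poisson variable and its inverse -/

section Joint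

/-- The variable that a letter stands for. -/
def letterVal {A : Type*} [Ring A] (X : Aˣ) (b : Bool) : A := if b then (X : A) else (↑X⁻¹ : A)

theorem commute_letterVal {A : Type*} [Ring A] (X : Aˣ) (b b' : Bool) :
    Commute (letterVal X b) (letterVal X b') := by
  cases b <;> cases b' <;> simp [letterVal, commute_iff_eq]

theorem word_eq_map {A : Type*} [Ring A] (X : Aˣ) {m : ℕ} (i : Fin m → ℕ) :
    word X i = (boolWord (List.ofFn i)).map (letterVal X) := by
  unfold word boolWord
  rw [List.map_flatMap]
  simp [letterVal]

variable {A : Type*} [Ring A] [StarRing A] [Algebra ℂ A] [StarModule ℂ A]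

theorem cumulantList_boolWord {φ : A →ₗ[ℂ] ℂ} (hφ : IsState φ) {X : Aˣ} {lam : ℝ}
    (hlam : 1 < lam) (hX : IsFreePoisson φ (X : A) lam 1) (l : List ℕ) (hl : l ≠ []) :
    cumulantList φ ((boolWord l).map (letterVal X)) =
      (l.map runSign).prod * cumulantList φ (List.replicate l.length (↑X⁻¹ : A)) := by
  have hmX := moment_pow hφ hlam hX
  have hmY := moment_inv_pow hφ hlam hX
  refine apply_boolWord (R := fun w => cumulantList φ (w.map (letterVal X)))
    (c := ((lam - 1 : ℝ) : ℂ)) (κ := fun n => cumulantList φ (List.replicate n (↑X⁻¹ : A)))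
    ?_ ?_ ?_ ?_ ?_ l hl
  · exact cumulantList_cyclic φ hφ.map_one (letterVal X) (commute_letterVal X)
  · intro n
    rw [List.map_replicate]
    refine cumulantList_replicate_of_recursion φ hφ.map_one (X : A) _ (fun n => ?_) n
    simp only [hmX]
    exact_mod_cast mpMoment_recursion hlam n
  · intro n
    rw [List.map_replicate]
    rfl
  · refine cumulantList_replicate_recursion φ hφ.map_one (↑X⁻¹ : A) _ fun n => ?_
    simp only [hmY]
    exact_mod_cast mpMoment_neg_recursion hlam n
  · intro w
    have h := cumulantList_contract φ hφ.map_one (Units.inv_mul X) (w.map (letterVal X))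
    rw [conv_map] at h
    have h2 : emptyWord (w.map (letterVal X)) = emptyWord w := by cases w <;> rfl
    rw [h2] at h
    exact h

end Joint

end FreeProb


theorem mainTheorem2 (lam : ℝ) (hlam : 1 < lam) :
    (∀ (A : Type*) [CStarAlgebra A] (φ : A →ₗ[ℂ] ℂ),
      FreeProb.IsState φ → FreeProb.IsFaithful φ →
      ∀ X : A, FreeProb.IsFreePoisson φ X lam 1 → IsUnit X) ∧
    (∀ (A : Type*) [Ring A] [StarRing A] [Algebra ℂ A] [StarModule ℂ A] (φ : A →ₗ[ℂ] ℂ),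
      FreeProb.IsState φ →
      ∀ X : Aˣ, FreeProb.IsFreePoisson φ (X : A) lam 1 →
      ∀ (m : ℕ), 1 ≤ m → ∀ i : Fin m → ℕ,
        ((∃ k, 1 < i k) → FreeProb.cumulantList φ (FreeProb.word X i) = 0) ∧
        ((∀ k, i k ≤ 1) → FreeProb.cumulantList φ (FreeProb.word X i) =
          (-1) ^ (∑ k, i k) * FreeProb.freeCumulant φ m (fun _ => (↑X⁻¹ : A)))) := by
  refine ⟨fun A _ φ hφ hfaith X hX => FreeProb.isUnit_of_isFreePoisson hφ hfaith hlam hX, ?_⟩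
  intro A _ _ _ _ φ hφ X hX m hm i
  have hne : List.ofFn i ≠ [] := by
    rw [Ne, List.ofFn_eq_nil_iff]
    omega
  have h := FreeProb.cumulantList_boolWord hφ hlam hX (List.ofFn i) hne
  rw [← FreeProb.word_eq_map, List.map_ofFn, List.prod_ofFn, List.length_ofFn] at h
  refine ⟨fun ⟨k, hk⟩ => ?_, fun hle => ?_⟩
  · rw [h, Finset.prod_eq_zero (Finset.mem_univ k), zero_mul]
    obtain ⟨j, hj⟩ : ∃ j, i k = j + 2 := ⟨i k - 2, by omega⟩
    simp [hj, FreeProb.runSign]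
  · rw [h, FreeProb.freeCumulant_eq_cumulantList, List.ofFn_const, ← Finset.prod_pow_eq_pow_sum]
    congr 1
    refine Finset.prod_congr rfl fun k _ => ?_
    have := hle k
    interval_cases hk : i k <;> simp [hk, FreeProb.runSign]
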